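/- Let $0<\varepsilon<1$ and let $m=m(n)$ be positive integers with $n=o(m)$ and $m=o(n^2)$ as $n\to\infty$. Let $p$ be the uniform probability mass function (p.m.f.) on $[m]=\{1,\dots,m\}$, let $d_{TV}(q,p)=\sup_{B\subseteq[m]}|q(B)-p(B)|$, and let $\mathcal Q_n$ be the set of all p.m.f.s $q$ on $[m]$ with $d_{TV}(q,p)\ge\varepsilon$. A test is a sequence $\phi=(\phi_n)_{n\ge1}$ of functions $\phi_n:[m]^n\to\{0,1\}$. Let $Z_1,\dots,Z_n$ be i.i.d. with p.m.f. $p$ under $\mathsf P_p$ and with p.m.f. $q$ under $\mathsf P_q$, and put $$P_F(\phi_n)=\mathsf P_p\{\phi_n(Z_1,\dots,Z_n)=1\},\qquad P_M(\phi_n)=\sup_{q\in\mathcal Q_n}\mathsf P_q\{\phi_n(Z_1,\dots,Z_n)=0\}.$$ The generalized error exponents of $\phi$ are the extended real numbers (with $\log 0=-\infty$) $$J_F(\phi)=-\limsup_{n\to\infty}\frac{m}{n^2}\log P_F(\phi_n),\qquad J_M(\phi)=-\limsup_{n\to\infty}\frac{m}{n^2}\log P_M(\phi_n).$$ Let $\kappa(\varepsilon)=1+4\varepsilon^2$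 if $\varepsilon<\frac12$ and $\kappa(\varepsilon)=1+\frac{\varepsilon}{1-\varepsilon}$ if $\varepsilon\ge\frac12$. For $\tau\in[0,\kappa(\varepsilon)-1]$ let $$J_F^*(\tau)=\sup_{\theta\ge0}\Bigl\{\theta\tau-\tfrac12\bigl(e^{2\theta}-(1+2\theta)\bigr)\Bigr\},\qquad J_M^*(\tau)=\sup_{\theta\ge0}\Bigl\{\theta(\kappa(\varepsilon)-1-\tau)-\tfrac12\bigl(e^{-2\theta}-(1-2\theta)\bigr)\kappa(\varepsilon)\Bigr\}.$$ **Theorem (Converse).** Let $\tau\in[0,\kappa(\varepsilon)-1]$. Every test $\phi$ with $J_F(\phi)\ge J_F^*(\tau)$, and, in the case $\tau=0$, such that $P_F(\phi_n)$ does not converge to $1$, satisfies $J_M(\phi)\le J_M^*(\tau)$. -/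

import Mathlib

open Filter Topology Asymptotics
open scoped ENNReal

noncomputable section

namespace SmallSampleTesting

/-- The uniform p.m.f. on an alphabet of `m` letters (the null hypothesis). -/
def unif (m : ℕ) : Fin m → ℝ := fun _ => 1 / (m : ℝ)

/-- Total variation distance `sup_B |q(B) - p(B)|`, over all subsets `B` of the alphabet. -/
def tvDist {m : ℕ} (q p : Fin m → ℝ) : ℝ :=
  ⨆ B : Finset (Fin m), |∑ j ∈ B, q j - ∑ j ∈ B, p j|

/-- The alternatives: all p.m.f.s on `m` letters (elements of the standard simplex) at total
variation distance at least `ε` from the uniform one. -/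
def alternatives (m : ℕ) (ε : ℝ) : Set (Fin m → ℝ) :=
  {q | q ∈ stdSimplex ℝ (Fin m) ∧ ε ≤ tvDist q (unif m)}

/-- Probability of the event `A` for a sample of `n` i.i.d. letters with p.m.f. `q`. -/
def iidProb {m n : ℕ} (q : Fin m → ℝ) (A : Finset (Fin n → Fin m)) : ℝ≥0∞ :=
  ENNReal.ofReal (∑ z ∈ A, ∏ i, q (z i))

/-- Probability of false alarm: the null hypothesis holds, but the test outputs `1` (`true`). -/
def probFalseAlarm {m n : ℕ} (φ : (Fin n → Fin m) → Bool) : ℝ≥0∞ :=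
  iidProb (unif m) {z | φ z = true}

/-- Worst-case probability of missed detection: supremum over the alternatives of the probability
that the test outputs `0` (`false`). -/
def probMissed {m n : ℕ} (ε : ℝ) (φ : (Fin n → Fin m) → Bool) : ℝ≥0∞ :=
  ⨆ q ∈ alternatives m ε, iidProb q {z | φ z = false}

/-- Generalized error exponent `-limsup (1 / r) log P` of a sequence of probabilities, with
`r = n ^ 2 / m`. It takes values in `[-∞, ∞]`, and `log 0 = -∞`. -/
def genExponent (m : ℕ → ℕ) (P : ℕ → ℝ≥0∞) : EReal :=
  -limsup (fun n : ℕ => (((1 : ℝ) / ((n : ℝ) ^ 2 / (m n : ℝ)) : ℝ) : EReal) * ENNReal.log (P n))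
    atTop

/-- Generalized error exponent of false alarm of a test (one decision function for each `n`). -/
def expFalseAlarm (m : ℕ → ℕ) (φ : ∀ n : ℕ, (Fin n → Fin (m n)) → Bool) : EReal :=
  genExponent m fun n => probFalseAlarm (φ n)

/-- Generalized error exponent of missed detection of a test. -/
def expMissed (m : ℕ → ℕ) (ε : ℝ) (φ : ∀ n : ℕ, (Fin n → Fin (m n)) → Bool) : EReal :=
  genExponent m fun n => probMissed ε (φ n)

/-- The function `κ`. -/
def kappa (ε : ℝ) : ℝ :=
  if ε < 1 / 2 then 1 + 4 * ε ^ 2 else 1 + ε / (1 - ε)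

/-- `J_F^*(τ)`, as a supremum in the extended reals. -/
def optFalseAlarm (τ : ℝ) : EReal :=
  ⨆ (θ : ℝ) (_ : 0 ≤ θ),
    ((θ * τ - 1 / 2 * (Real.exp (2 * θ) - (1 + 2 * θ)) : ℝ) : EReal)

/-- `J_M^*(τ)`, as a supremum in the extended reals. -/
def optMissed (ε τ : ℝ) : EReal :=
  ⨆ (θ : ℝ) (_ : 0 ≤ θ),
    ((θ * (kappa ε - 1 - τ)
      - 1 / 2 * (Real.exp (-2 * θ) - (1 - 2 * θ)) * kappa ε : ℝ) : EReal)

end SmallSampleTesting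

end

/-!
The problem is a test between two Poisson variables in disguise. Put `r = n ^ 2 / m`. In a sample
of `n` letters, the number of letters that occur twice behaves like a Poisson variable, with mean
`r / 2` under the uniform p.m.f., and with mean `κ r / 2` under a least favourable alternative `q`,
for which `m ∑ q ^ 2 → κ`. Under a uniformly random relabelling of `q` the sample carries, at the
scale of the exponents, no further information. The two exponents are those of a threshold test at
`(1 + τ) r / 2`.

Let `A` (`pairWords`) be the set of words in which exactly `j = ⌊t r⌋` letters occur twice and no
letter occurs more often. After averaging over the relabellings of `q`, all words of `A` are equally
likely, and by Muirhead's inequality (`permSum_le_of_isPairType`) no word with at least `j` repeated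
letters (`repeatWords`) is less likely than those of `A`. So if the test accepts a set `B` of such
words, then some relabelling of `q` gives `B` at least the probability `q(A) * card B / card A`
(`exists_perm_prob_ge`). It remains to find an accepted `B` whose size is at least a constant times
`card A`, and to bound `q(A)` from below by `exp (-r (poissonRate κ t + o(1)))`.

* The bound on `q(A)` (`eventually_exp_le_sum_pairWords`) is a count of words times a product of two
  elementary symmetric sums, in the `q c ^ 2` for the repeated letters, and in the `q c` for the
  others. Both are instances of the birthday problem, for which the union bound on the conditional
  collision probabilities remains valid given distinctness, by a Chebyshev inequality
  (`elemSum_succ_ge`).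
* If `0 < τ`, take `1 / 2 < t < (1 + τ) / 2`. The same bound, applied to the uniform p.m.f., shows
  that the probability of `A` under the null hypothesis decays more slowly than the probability of
  false alarm, so the test accepts half of `A` (`eventually_card_accepted_pairWords`).
* If `τ = 0`, take `t < 1 / 2`. By a law of large numbers (`tendsto_card_compl_repeatWords`), almost
  every word has at least `j` repeated letters, and the test accepts a positive share of all words
  infinitely often (`frequently_card_accepted_repeatWords`).

Letting `t` tend to `(1 + τ) / 2` gives `poissonRate κ ((1 + τ) / 2)`, which is at most `J_M^*(τ)`.
-/

namespace SmallSampleTesting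

/-! ### Words and their letter counts -/

section Words

variable {α : Type*} [Fintype α] [DecidableEq α]

/-- The number of occurrences of the letter `c` in the word `z`. -/
def letterCount {n : ℕ} (z : Fin n → α) (c : α) : ℕ :=
  (Finset.univ.filter fun i => z i = c).card

omit [Fintype α] in
theorem letterCount_cons {n : ℕ} (a : α) (z : Fin n → α) :
    letterCount (Fin.cons a z : Fin (n + 1) → α) = letterCount z + Pi.single a 1 := by
  funext c
  simp only [letterCount, Finset.card_filter, Fin.sum_univ_succ, Fin.cons_zero, Fin.cons_succ,
    Pi.add_apply, Pi.single_apply]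
  rw [add_comm]
  simp [eq_comm]

theorem sum_letterCount {n : ℕ} (z : Fin n → α) : ∑ c, letterCount z c = n := by
  have h := Finset.card_eq_sum_card_fiberwise (f := z) (s := Finset.univ) (t := Finset.univ)
    (fun _ _ => Finset.mem_coe.2 (Finset.mem_univ _))
  simpa [letterCount] using h.symm

theorem prod_word_eq {M : Type*} [CommMonoid M] {n : ℕ} (f : α → M) (z : Fin n → α) :
    ∏ i, f (z i) = ∏ c, f c ^ letterCount z c := by
  rw [← Finset.prod_fiberwise_of_maps_to (g := z) (s := Finset.univ) (t := Finset.univ)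
    (fun _ _ => Finset.mem_univ _)]
  refine Finset.prod_congr rfl fun c _ => ?_
  rw [letterCount, Finset.prod_congr rfl (g := fun _ => f c), Finset.prod_const]
  intro i hi
  rw [(Finset.mem_filter.1 hi).2]

omit [DecidableEq α] in
theorem sum_word_cons {M : Type*} [AddCommMonoid M] {n : ℕ} (f : (Fin (n + 1) → α) → M) :
    ∑ z, f z = ∑ a, ∑ z : Fin n → α, f (Fin.cons a z) := by
  rw [← (Fin.consEquiv fun _ : Fin (n + 1) => α).sum_comp, Fintype.sum_prod_type]
  rfl

/-- The multinomial count of the words with prescribed letter counts. -/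
theorem card_letterCount_eq_mul_prod_factorial {n : ℕ} (k : α → ℕ) (hk : ∑ c, k c = n) :
    (Finset.univ.filter fun z : Fin n → α => letterCount z = k).card * ∏ c, (k c).factorial
      = n.factorial := by
  induction n generalizing k with
  | zero =>
    have h0 : k = 0 := by
      funext c
      exact (Finset.sum_eq_zero_iff.1 hk) c (Finset.mem_univ c)
    subst h0
    have : (Finset.univ.filter fun z : Fin 0 → α => letterCount z = 0) = Finset.univ := by
      ext z
      simp only [Finset.mem_filter, Finset.mem_univ, true_and, iff_true]
      funext c
      simp [letterCount]
    rw [this]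
    simp
  | succ n ih =>
    rw [Finset.card_filter, sum_word_cons, Finset.sum_mul]
    have key : ∀ a, (∑ z : Fin n → α, if letterCount (Fin.cons a z : Fin (n + 1) → α) = k
        then 1 else 0) * ∏ c, (k c).factorial = k a * n.factorial := by
      intro a
      rcases Nat.eq_zero_or_pos (k a) with h | h
      · rw [h, zero_mul, Finset.sum_eq_zero, zero_mul]
        intro z _
        rw [if_neg]
        intro he
        have := congrFun he a
        rw [letterCount_cons] at this
        simp [h] at this
      · have hsub : ∀ z : Fin n → α, letterCount (Fin.cons a z : Fin (n + 1) → α) = k ↔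
            letterCount z = Function.update k a (k a - 1) := by
          intro z
          rw [letterCount_cons]
          constructor
          · intro he
            subst he
            funext c
            by_cases hc : c = a
            · subst hc; simp
            · simp [hc]
          · intro he
            rw [he]
            funext c
            by_cases hc : c = a
            · subst hc; simp; omega
            · simp [hc]
        simp only [hsub]
        rw [← Finset.card_filter]
        have hs : ∑ c, Function.update k a (k a - 1) c = n := by
          rw [Finset.sum_update_of_mem (Finset.mem_univ a)]
          rw [← Finset.add_sum_erase _ _ (Finset.mem_univ a)] at hk
          rw [Finset.sdiff_singleton_eq_erase]
          omega
        have := ih _ hs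
        have hp : ∏ c, (k c).factorial
            = k a * ∏ c, (Function.update k a (k a - 1) c).factorial := by
          rw [← Finset.mul_prod_erase _ _ (Finset.mem_univ a),
            ← Finset.mul_prod_erase _ (fun c => (Function.update k a (k a - 1) c).factorial)
              (Finset.mem_univ a), Function.update_self, ← mul_assoc,
            Nat.mul_factorial_pred (by omega)]
          congr 1
          refine Finset.prod_congr rfl fun c hc => ?_
          rw [Function.update_of_ne (Finset.ne_of_mem_erase hc)]
        rw [hp, ← this]
        ring
    rw [Finset.sum_congr rfl fun a _ => key a, ← Finset.sum_mul, hk, Nat.factorial_succ]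

end Words

/-! ### Averaging over relabellings of the alphabet -/

section Relabelling

variable {α : Type*} [Fintype α] [DecidableEq α]

/-- The symmetrized monomial with exponents `k`, evaluated at `q`. Up to the factor
`1 / (card α)!`, it is the average probability, over all relabellings of the p.m.f. `q`, of a word
with letter counts `k`. -/
def permSum (q : α → ℝ) (k : α → ℕ) : ℝ :=
  ∑ σ : Equiv.Perm α, ∏ c, q (σ c) ^ k c

theorem permSum_comp (q : α → ℝ) (k : α → ℕ) (τ : Equiv.Perm α) :
    permSum q (k ∘ τ) = permSum q k := by
  unfold permSum
  refine (Equiv.sum_comp (Equiv.mulRight τ)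
    fun σ : Equiv.Perm α => ∏ c, q (σ c) ^ (k ∘ τ) c).symm.trans ?_
  refine Finset.sum_congr rfl fun σ _ => ?_
  exact Equiv.prod_comp τ fun c => q (σ c) ^ k c

/-- One step of Muirhead's inequality: moving one unit of the exponent from `c` to a letter `d` with
exponent zero decreases the symmetrized monomial. -/
theorem permSum_update_le {q : α → ℝ} (hq : ∀ c, 0 ≤ q c) (k : α → ℕ) {c d : α} (hcd : c ≠ d)
    {u : ℕ} (hc : k c = u + 1) (hd : k d = 0) :
    permSum q (Function.update (Function.update k c u) d 1) ≤ permSum q k := by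
  have split : ∀ (f : α → ℝ), ∏ e, f e = f c * f d * ∏ e ∈ (Finset.univ.erase c).erase d, f e := by
    intro f
    rw [mul_assoc, Finset.mul_prod_erase _ f (Finset.mem_erase.2 ⟨hcd.symm, Finset.mem_univ d⟩),
      Finset.mul_prod_erase _ f (Finset.mem_univ c)]
  have hne : ∀ e ∈ (Finset.univ.erase c).erase d, e ≠ c ∧ e ≠ d := by
    intro e he
    simp only [Finset.mem_erase] at he
    exact ⟨he.2.1, he.1⟩
  have h2 : ∀ k : α → ℕ, 2 * permSum q k = ∑ σ : Equiv.Perm α,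
      (q (σ c) ^ k c * q (σ d) ^ k d + q (σ c) ^ k d * q (σ d) ^ k c) *
        ∏ e ∈ (Finset.univ.erase c).erase d, q (σ e) ^ k e := by
    intro k
    rw [two_mul]
    nth_rewrite 2 [← permSum_comp q k (Equiv.swap c d)]
    unfold permSum
    rw [← Finset.sum_add_distrib]
    refine Finset.sum_congr rfl fun σ _ => ?_
    rw [split, split]
    simp only [Function.comp, Equiv.swap_apply_left, Equiv.swap_apply_right]
    rw [Finset.prod_congr rfl (g := fun e => q (σ e) ^ k e)
      (s₁ := (Finset.univ.erase c).erase d) (f := fun e => q (σ e) ^ k (Equiv.swap c d e))]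
    · ring
    · intro e he
      rw [Equiv.swap_apply_of_ne_of_ne (hne e he).1 (hne e he).2]
  have : 2 * permSum q (Function.update (Function.update k c u) d 1) ≤ 2 * permSum q k := by
    rw [h2, h2]
    refine Finset.sum_le_sum fun σ _ => ?_
    have hr : ∏ e ∈ (Finset.univ.erase c).erase d,
        q (σ e) ^ Function.update (Function.update k c u) d 1 e
        = ∏ e ∈ (Finset.univ.erase c).erase d, q (σ e) ^ k e := by
      refine Finset.prod_congr rfl fun e he => ?_
      rw [Function.update_of_ne (hne e he).2, Function.update_of_ne (hne e he).1]
    rw [hr]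
    refine mul_le_mul_of_nonneg_right ?_
      (Finset.prod_nonneg fun _ _ => pow_nonneg (hq _) _)
    rw [Function.update_self, Function.update_of_ne hcd, Function.update_self, hc, hd]
    have hx := hq (σ c)
    have hy := hq (σ d)
    have : 0 ≤ (q (σ c) ^ u - q (σ d) ^ u) * (q (σ c) - q (σ d)) := by
      rcases le_total (q (σ c)) (q (σ d)) with h | h
      · exact mul_nonneg_of_nonpos_of_nonpos (sub_nonpos.2 (pow_le_pow_left₀ hx h u))
          (sub_nonpos.2 h)
      · exact mul_nonneg (sub_nonneg.2 (pow_le_pow_left₀ hy h u)) (sub_nonneg.2 h)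
    simp only [pow_succ, pow_zero, one_mul, mul_one]
    nlinarith
  linarith

/-- The letter counts `k` consist of exactly `j` twos, and of ones and zeros otherwise. -/
def IsPairType (j : ℕ) (k : α → ℕ) : Prop :=
  (∀ c, k c ≤ 2) ∧ (Finset.univ.filter fun c => k c = 2).card = j

instance (j : ℕ) (k : α → ℕ) : Decidable (IsPairType j k) :=
  inferInstanceAs (Decidable (_ ∧ _))

omit [DecidableEq α] in
theorem IsPairType.card_one {j n : ℕ} {k : α → ℕ} (hk : IsPairType j k) (hn : ∑ c, k c = n) :
    (Finset.univ.filter fun c => k c = 1).card + 2 * j = n := by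
  rw [← hk.2, ← hn, Finset.card_filter, Finset.card_filter, Finset.mul_sum,
    ← Finset.sum_add_distrib]
  refine Finset.sum_congr rfl fun c _ => ?_
  have := hk.1 c
  interval_cases k c <;> simp

omit [DecidableEq α] in
theorem IsPairType.card_zero {j n : ℕ} {k : α → ℕ} (hk : IsPairType j k) (hn : ∑ c, k c = n) :
    (Finset.univ.filter fun c => k c = 0).card + n = Fintype.card α + j := by
  rw [← hk.2, ← hn, ← Finset.card_univ, Finset.card_filter,
    Finset.card_filter, Finset.card_eq_sum_ones, ← Finset.sum_add_distrib, ← Finset.sum_add_distrib]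
  refine Finset.sum_congr rfl fun c _ => ?_
  have := hk.1 c
  interval_cases k c <;> simp

omit [DecidableEq α] in
theorem IsPairType.exists_perm {j n : ℕ} {k l : α → ℕ} (hk : IsPairType j k)
    (hl : IsPairType j l) (hkn : ∑ c, k c = n) (hln : ∑ c, l c = n) :
    ∃ τ : Equiv.Perm α, k = l ∘ τ := by
  have h : ∀ v : ℕ, Nonempty ({c // k c = v} ≃ {c // l c = v}) := by
    intro v
    refine Fintype.card_eq.1 ?_
    rw [Fintype.card_subtype, Fintype.card_subtype]
    have hk1 := hk.card_one hkn
    have hl1 := hl.card_one hln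
    have hk0 := hk.card_zero hkn
    have hl0 := hl.card_zero hln
    rcases v with _ | _ | _ | v
    · omega
    · simp only [zero_add]; omega
    · exact hk.2.trans hl.2.symm
    · rw [Finset.filter_eq_empty_iff.2, Finset.filter_eq_empty_iff.2]
      · intro c _ h; have := hl.1 c; omega
      · intro c _ h; have := hk.1 c; omega
  refine ⟨Equiv.ofFiberEquiv fun v => (h v).some, funext fun c => ?_⟩
  exact (Equiv.ofFiberEquiv_map _ c).symm

/-- Among all exponents with the same sum `n` and at least `j` entries `≥ 2`, the symmetrized
monomial is smallest at the type with `j` twos: repeatedly move units to unused letters. -/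
theorem permSum_le_of_isPairType {q : α → ℝ} (hq : ∀ c, 0 ≤ q c) {j n : ℕ}
    (hn : n ≤ Fintype.card α) {k₀ : α → ℕ} (h₀ : IsPairType j k₀) (h₀n : ∑ c, k₀ c = n)
    (k : α → ℕ) (hkn : ∑ c, k c = n) (hj : j ≤ (Finset.univ.filter fun c => 2 ≤ k c).card) :
    permSum q k₀ ≤ permSum q k := by
  induction hs : ∑ c, (k c - 1) using Nat.strong_induction_on generalizing k with
  | _ s ih =>
  by_cases hk : IsPairType j k
  · obtain ⟨τ, rfl⟩ := h₀.exists_perm hk h₀n hkn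
    rw [permSum_comp]
  obtain ⟨c, hc2, hc⟩ : ∃ c, 2 ≤ k c ∧
      (3 ≤ k c ∨ j < (Finset.univ.filter fun c => 2 ≤ k c).card) := by
    by_cases h3 : ∃ c, 3 ≤ k c
    · obtain ⟨c, h⟩ := h3
      exact ⟨c, by omega, Or.inl h⟩
    · have h3' : ∀ c, k c ≤ 2 := fun c => by
        by_contra h
        exact h3 ⟨c, by omega⟩
      have heq : (Finset.univ.filter fun c => 2 ≤ k c) = Finset.univ.filter fun c => k c = 2 := by
        ext c
        have := h3' c
        simp only [Finset.mem_filter, Finset.mem_univ, true_and]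
        omega
      have hlt : j < (Finset.univ.filter fun c => 2 ≤ k c).card := by
        refine lt_of_le_of_ne hj fun h => hk ⟨h3', ?_⟩
        rw [← heq, h]
      obtain ⟨c, hc⟩ := Finset.card_pos.1 (lt_of_le_of_lt (Nat.zero_le j) hlt)
      exact ⟨c, (Finset.mem_filter.1 hc).2, Or.inr hlt⟩
  obtain ⟨d, hd⟩ : ∃ d, k d = 0 := by
    by_contra! h
    have h1 : ∑ _e : α, 1 < ∑ e, k e :=
      Finset.sum_lt_sum (fun e _ => Nat.one_le_iff_ne_zero.2 (h e)) ⟨c, Finset.mem_univ c, by omega⟩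
    simp at h1
    omega
  have hcd : c ≠ d := by rintro rfl; omega
  obtain ⟨u, hu⟩ : ∃ u, k c = u + 1 := ⟨k c - 1, by omega⟩
  refine le_trans ?_ (permSum_update_le hq k hcd hu hd)
  have split : ∀ f : α → ℕ, ∑ e, f e = f c + f d + ∑ e ∈ (Finset.univ.erase c).erase d, f e := by
    intro f
    rw [add_assoc, Finset.add_sum_erase _ f (Finset.mem_erase.2 ⟨hcd.symm, Finset.mem_univ d⟩),
      Finset.add_sum_erase _ f (Finset.mem_univ c)]
  set k' := Function.update (Function.update k c u) d 1 with hk'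
  have hk'c : k' c = u := by rw [hk', Function.update_of_ne hcd, Function.update_self]
  have hk'd : k' d = 1 := by rw [hk', Function.update_self]
  have hk'e : ∀ e ∈ (Finset.univ.erase c).erase d, k' e = k e := by
    intro e he
    simp only [Finset.mem_erase] at he
    rw [hk', Function.update_of_ne he.1, Function.update_of_ne he.2.1]
  refine ih _ ?_ k' ?_ ?_ rfl
  · rw [← hs, split, split fun e => k e - 1, hk'c, hk'd, hu, hd,
      Finset.sum_congr rfl fun e he => by rw [hk'e e he]]
    omega
  · rw [← hkn, split, split k, hk'c, hk'd, hu, hd, Finset.sum_congr rfl hk'e]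
  · rw [Finset.card_filter, split] at hj hc ⊢
    rw [hk'c, hk'd, Finset.sum_congr (s₂ := (Finset.univ.erase c).erase d)
      (g := fun e => if 2 ≤ k e then 1 else 0) rfl fun e he => by rw [hk'e e he]]
    simp only [hu, hd] at hj hc ⊢
    split_ifs at hj hc ⊢ <;> omega

/-- The words of length `n` in which exactly `j` letters occur twice, and no letter more often. -/
def pairWords (α : Type*) [Fintype α] [DecidableEq α] (n j : ℕ) : Finset (Fin n → α) :=
  Finset.univ.filter fun z => IsPairType j (letterCount z)

theorem mem_pairWords {n j : ℕ} {z : Fin n → α} :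
    z ∈ pairWords α n j ↔ IsPairType j (letterCount z) := by
  simp [pairWords]

/-- The words of length `n` with at least `j` repeated letters. -/
def repeatWords (α : Type*) [Fintype α] [DecidableEq α] (n j : ℕ) : Finset (Fin n → α) :=
  Finset.univ.filter fun z => j ≤ (Finset.univ.filter fun c => 2 ≤ letterCount z c).card

theorem mem_repeatWords {n j : ℕ} {z : Fin n → α} :
    z ∈ repeatWords α n j ↔ j ≤ (Finset.univ.filter fun c => 2 ≤ letterCount z c).card := by
  simp [repeatWords]

theorem pairWords_subset_repeatWords (n j : ℕ) : pairWords α n j ⊆ repeatWords α n j := by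
  intro z hz
  rw [mem_pairWords] at hz
  rw [mem_repeatWords, ← hz.2]
  refine Finset.card_le_card fun c => ?_
  simp only [Finset.mem_filter, Finset.mem_univ, true_and]
  exact fun h => h.ge

/-- For words with at least `j` repeated letters, some relabelling of `q` gives a set `B` at least
the share `card B / card (pairWords α n j)` of the probability that `q` gives to `pairWords α n j`:
the average over all relabellings does, since the likelihood is constant on `pairWords α n j` after
averaging, and not smaller on `B`. -/
theorem exists_perm_prob_ge {q : α → ℝ} (hq : ∀ c, 0 ≤ q c) {n j : ℕ}
    (hn : n ≤ Fintype.card α) {B : Finset (Fin n → α)} (hB : B ⊆ repeatWords α n j) :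
    ∃ σ : Equiv.Perm α, (∑ z ∈ pairWords α n j, ∏ i, q (z i)) * B.card
      ≤ (pairWords α n j).card * ∑ z ∈ B, ∏ i, q (σ (z i)) := by
  rcases (pairWords α n j).eq_empty_or_nonempty with h | ⟨z₀, hz₀⟩
  · exact ⟨1, by simp [h]⟩
  have hswap : ∀ C : Finset (Fin n → α), ∑ σ : Equiv.Perm α, ∑ z ∈ C, ∏ i, q (σ (z i))
      = ∑ z ∈ C, permSum q (letterCount z) := by
    intro C
    rw [Finset.sum_comm]
    refine Finset.sum_congr rfl fun z _ => Finset.sum_congr rfl fun σ _ => ?_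
    exact prod_word_eq (fun c => q (σ c)) z
  have hinv : ∀ σ : Equiv.Perm α, ∑ z ∈ pairWords α n j, ∏ i, q (σ (z i))
      = ∑ z ∈ pairWords α n j, ∏ i, q (z i) := by
    intro σ
    refine Finset.sum_bij' (fun z _ => σ ∘ z) (fun z _ => σ.symm ∘ z) ?_ ?_ ?_ ?_ ?_
    · intro z hz
      rw [mem_pairWords] at hz ⊢
      have he : letterCount (σ ∘ z) = letterCount z ∘ σ.symm := by
        funext c
        simp only [letterCount, Function.comp, ← Equiv.eq_symm_apply]
      rw [he]
      refine ⟨fun c => hz.1 _, ?_⟩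
      rw [← hz.2, Finset.card_filter, Finset.card_filter]
      exact Equiv.sum_comp σ.symm fun c => if letterCount z c = 2 then 1 else 0
    · intro z hz
      rw [mem_pairWords] at hz ⊢
      have he : letterCount (σ.symm ∘ z) = letterCount z ∘ σ := by
        funext c
        simp only [letterCount, Function.comp, Equiv.symm_apply_eq]
      rw [he]
      refine ⟨fun c => hz.1 _, ?_⟩
      rw [← hz.2, Finset.card_filter, Finset.card_filter]
      exact Equiv.sum_comp σ fun c => if letterCount z c = 2 then 1 else 0
    · intro z _; funext i; simp
    · intro z _; funext i; simp
    · intro z _; rfl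
  have hA := hswap (pairWords α n j)
  rw [Finset.sum_congr rfl fun σ _ => hinv σ, Finset.sum_const, nsmul_eq_mul] at hA
  have hAle : ∑ z ∈ pairWords α n j, permSum q (letterCount z)
      = (pairWords α n j).card * permSum q (letterCount z₀) := by
    rw [Finset.sum_congr rfl (g := fun _ => permSum q (letterCount z₀)), Finset.sum_const,
      nsmul_eq_mul]
    intro z hz
    rw [mem_pairWords] at hz hz₀
    obtain ⟨τ, hτ⟩ := hz.exists_perm hz₀ (sum_letterCount z) (sum_letterCount z₀)
    rw [hτ, permSum_comp]
  have hBge : B.card * permSum q (letterCount z₀) ≤ ∑ z ∈ B, permSum q (letterCount z) := by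
    rw [← nsmul_eq_mul, ← Finset.sum_const]
    refine Finset.sum_le_sum fun z hz => ?_
    exact permSum_le_of_isPairType hq hn (mem_pairWords.1 hz₀) (sum_letterCount z₀) _
      (sum_letterCount z) (mem_repeatWords.1 (hB hz))
  have hsum : ∑ _σ : Equiv.Perm α, (∑ z ∈ pairWords α n j, ∏ i, q (z i)) * B.card
      ≤ ∑ σ : Equiv.Perm α, (pairWords α n j).card * ∑ z ∈ B, ∏ i, q (σ (z i)) := by
    rw [Finset.sum_const, ← Finset.mul_sum, hswap B, nsmul_eq_mul, ← mul_assoc, hA, hAle, mul_assoc]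
    refine mul_le_mul_of_nonneg_left ?_ (Nat.cast_nonneg _)
    rwa [mul_comm]
  obtain ⟨σ, -, h⟩ := Finset.exists_le_of_sum_le Finset.univ_nonempty hsum
  exact ⟨σ, h⟩

end Relabelling

/-! ### Elementary symmetric sums: a birthday-problem bound -/

section ElemSum

variable {α : Type*} [DecidableEq α]

/-- The elementary symmetric polynomial of degree `n` in the variables `y c`, `c ∈ s`. -/
def elemSum (y : α → ℝ) (s : Finset α) (n : ℕ) : ℝ :=
  ∑ A ∈ s.powersetCard n, ∏ c ∈ A, y c

omit [DecidableEq α] in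
theorem elemSum_zero (y : α → ℝ) (s : Finset α) : elemSum y s 0 = 1 := by
  simp [elemSum]

omit [DecidableEq α] in
theorem elemSum_nonneg {y : α → ℝ} (hy : ∀ c, 0 ≤ y c) (s : Finset α) (n : ℕ) :
    0 ≤ elemSum y s n :=
  Finset.sum_nonneg fun _ _ => Finset.prod_nonneg fun c _ => hy c

theorem elemSum_insert (y : α → ℝ) {s : Finset α} {d : α} (hd : d ∉ s) (n : ℕ) :
    elemSum y (insert d s) (n + 1) = elemSum y s (n + 1) + y d * elemSum y s n := by
  unfold elemSum
  rw [Finset.powersetCard_succ_insert hd, Finset.sum_union, Finset.sum_image, Finset.mul_sum]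
  · congr 1
    refine Finset.sum_congr rfl fun A hA => ?_
    rw [Finset.prod_insert]
    exact fun h => hd ((Finset.mem_powersetCard.1 hA).1 h)
  · intro A hA B hB h
    have hA' : d ∉ A := fun h => hd ((Finset.mem_powersetCard.1 hA).1 h)
    have hB' : d ∉ B := fun h => hd ((Finset.mem_powersetCard.1 hB).1 h)
    rw [← Finset.erase_insert hA', ← Finset.erase_insert hB', h]
  · rw [Finset.disjoint_left]
    intro A hA hA'
    obtain ⟨B, -, rfl⟩ := Finset.mem_image.1 hA'
    exact hd ((Finset.mem_powersetCard.1 hA).1 (Finset.mem_insert_self _ _))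

theorem elemSum_erase (y : α → ℝ) {s : Finset α} {d : α} (hd : d ∈ s) (n : ℕ) :
    elemSum y s (n + 1) = elemSum y (s.erase d) (n + 1) + y d * elemSum y (s.erase d) n := by
  rw [← elemSum_insert y (Finset.notMem_erase d s), Finset.insert_erase hd]

theorem sum_mul_elemSum_erase (y : α → ℝ) (s : Finset α) (n : ℕ) :
    ∑ c ∈ s, y c * elemSum y (s.erase c) n = (n + 1) * elemSum y s (n + 1) := by
  induction s using Finset.induction_on generalizing n with
  | empty =>
    have h : (∅ : Finset α).powersetCard (n + 1) = ∅ := Finset.powersetCard_eq_empty.2 (by simp)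
    simp [elemSum, h]
  | insert d s hd ih =>
    have he : ∀ c ∈ s, (insert d s).erase c = insert d (s.erase c) := fun c hc =>
      Finset.erase_insert_of_ne (by rintro rfl; exact hd hc)
    have hd' : ∀ c, d ∉ s.erase c := fun c h => hd (Finset.mem_of_mem_erase h)
    rw [Finset.sum_insert hd, Finset.erase_insert hd, elemSum_insert y hd]
    rcases n with _ | n
    · have h0 := ih 0
      simp only [elemSum_zero, mul_one] at h0 ⊢
      rw [h0]
      push_cast
      ring
    · rw [Finset.sum_congr rfl (g := fun c => y c * elemSum y (s.erase c) (n + 1)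
        + y d * (y c * elemSum y (s.erase c) n)), Finset.sum_add_distrib, ← Finset.mul_sum,
        ih, ih]
      · push_cast
        ring
      · intro c hc
        rw [he c hc, elemSum_insert y (hd' c)]
        ring

/-- Weighted Chebyshev inequality: a letter with a larger weight leaves a smaller elementary
symmetric sum behind. -/
theorem sum_sq_mul_elemSum_erase_le {y : α → ℝ} (hy : ∀ c, 0 ≤ y c) (s : Finset α) (n : ℕ) :
    (∑ c ∈ s, y c) * ∑ c ∈ s, y c ^ 2 * elemSum y (s.erase c) n
      ≤ (∑ c ∈ s, y c ^ 2) * ∑ c ∈ s, y c * elemSum y (s.erase c) n := by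
  have hanti : ∀ c ∈ s, ∀ d ∈ s,
      (y c - y d) * (elemSum y (s.erase c) n - elemSum y (s.erase d) n) ≤ 0 := by
    intro c hc d hd
    rcases eq_or_ne c d with rfl | hcd
    · simp
    rcases n with _ | n
    · simp [elemSum_zero]
    rw [elemSum_erase y (Finset.mem_erase.2 ⟨hcd.symm, hd⟩),
      elemSum_erase y (s := s.erase d) (Finset.mem_erase.2 ⟨hcd, hc⟩), Finset.erase_right_comm]
    have := mul_nonneg (sq_nonneg (y c - y d)) (elemSum_nonneg hy ((s.erase d).erase c) n)
    nlinarith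
  have hsum : ∑ c ∈ s, ∑ d ∈ s, y c * y d *
      ((y c - y d) * (elemSum y (s.erase c) n - elemSum y (s.erase d) n)) ≤ 0 :=
    Finset.sum_nonpos fun c hc => Finset.sum_nonpos fun d hd =>
      mul_nonpos_of_nonneg_of_nonpos (mul_nonneg (hy c) (hy d)) (hanti c hc d hd)
  have hexp : ∑ c ∈ s, ∑ d ∈ s, y c * y d *
      ((y c - y d) * (elemSum y (s.erase c) n - elemSum y (s.erase d) n))
      = 2 * ((∑ c ∈ s, y c) * ∑ c ∈ s, y c ^ 2 * elemSum y (s.erase c) n)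
        - 2 * ((∑ c ∈ s, y c ^ 2) * ∑ c ∈ s, y c * elemSum y (s.erase c) n) := by
    have h1 : ∀ f g : α → ℝ, (∑ c ∈ s, f c) * ∑ c ∈ s, g c = ∑ c ∈ s, ∑ d ∈ s, f c * g d :=
      fun f g => Finset.sum_mul_sum s s f g
    rw [two_mul, two_mul]
    nth_rewrite 2 [mul_comm (∑ c ∈ s, y c)]
    nth_rewrite 2 [mul_comm (∑ c ∈ s, y c ^ 2)]
    simp only [h1, ← Finset.sum_add_distrib, ← Finset.sum_sub_distrib]
    refine Finset.sum_congr rfl fun c _ => Finset.sum_congr rfl fun d _ => ?_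
    ring
  linarith

/-- In the birthday problem, the conditional probability that one more draw is distinct from the
`n` distinct letters drawn before is at least `1 - n B / T ^ 2`, as in the union bound: conditioning
on distinctness makes heavy letters less likely. -/
theorem elemSum_succ_ge {y : α → ℝ} (hy : ∀ c, 0 ≤ y c) {s : Finset α} {T B : ℝ} (hT : 0 < T)
    (hTs : T ≤ ∑ c ∈ s, y c) (hB : ∑ c ∈ s, y c ^ 2 ≤ B) (n : ℕ) :
    (T - n * B / T) * elemSum y s n ≤ (n + 1) * elemSum y s (n + 1) := by
  rw [← sum_mul_elemSum_erase]
  rcases n with _ | n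
  · simp only [elemSum_zero, mul_one]
    simpa using hTs
  have h1 : ∀ c ∈ s, y c * elemSum y (s.erase c) (n + 1)
      = y c * elemSum y s (n + 1) - y c ^ 2 * elemSum y (s.erase c) n := by
    intro c hc
    rw [elemSum_erase y hc]
    ring
  rw [Finset.sum_congr rfl h1, Finset.sum_sub_distrib, ← Finset.sum_mul]
  have h2 := sum_sq_mul_elemSum_erase_le hy s n
  rw [sum_mul_elemSum_erase] at h2
  set S := ∑ c ∈ s, y c
  set Q := ∑ c ∈ s, y c ^ 2 * elemSum y (s.erase c) n
  set E := elemSum y s (n + 1)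
  have hE : 0 ≤ E := elemSum_nonneg hy _ _
  have hQ : 0 ≤ Q := Finset.sum_nonneg fun c _ => mul_nonneg (sq_nonneg _) (elemSum_nonneg hy _ _)
  have h3 : T * Q ≤ B * (((n : ℝ) + 1) * E) :=
    ((mul_le_mul_of_nonneg_right hTs hQ).trans h2).trans
      (mul_le_mul_of_nonneg_right hB (by positivity))
  have h4 : Q ≤ (n + 1) * B / T * E := by
    rw [div_mul_eq_mul_div, le_div_iff₀ hT]
    linarith
  have h5 : T * E ≤ S * E := mul_le_mul_of_nonneg_right hTs hE
  push_cast
  linarith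

theorem factorial_mul_elemSum_ge {y : α → ℝ} (hy : ∀ c, 0 ≤ y c) {s : Finset α} {T B : ℝ}
    (hT : 0 < T) (hTs : T ≤ ∑ c ∈ s, y c) (hB : ∑ c ∈ s, y c ^ 2 ≤ B) (n : ℕ)
    (hn : ∀ i < n, 0 ≤ T - i * B / T) :
    ∏ i ∈ Finset.range n, (T - i * B / T) ≤ n.factorial * elemSum y s n := by
  induction n with
  | zero => simp [elemSum_zero]
  | succ n ih =>
    rw [Finset.prod_range_succ, Nat.factorial_succ]
    have h1 := ih fun i hi => hn i (by omega)
    have h2 := elemSum_succ_ge hy hT hTs hB n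
    have h3 := mul_le_mul_of_nonneg_right h1 (hn n (by omega))
    have h4 : (0 : ℝ) ≤ n.factorial := Nat.cast_nonneg _
    have h5 := mul_le_mul_of_nonneg_left h2 h4
    push_cast
    linarith

end ElemSum

/-! ### The probability of words with a prescribed number of repeated letters -/

section PairProb

variable {α : Type*} [Fintype α] [DecidableEq α]

/-- The letter counts of a word in which the letters of `D` occur twice, and those of `S` once. -/
def pairCount (D S : Finset α) (c : α) : ℕ :=
  if c ∈ D then 2 else if c ∈ S then 1 else 0

theorem prod_pairCount {M : Type*} [CommMonoid M] {D S : Finset α} (h : Disjoint D S)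
    (F : α → ℕ → M) (hF : ∀ c, F c 0 = 1) :
    ∏ c, F c (pairCount D S c) = (∏ c ∈ D, F c 2) * ∏ c ∈ S, F c 1 := by
  have h1 : ∀ c, F c (pairCount D S c)
      = (if c ∈ D then F c 2 else 1) * (if c ∈ S then F c 1 else 1) := by
    intro c
    unfold pairCount
    by_cases hD : c ∈ D
    · simp [hD, Finset.disjoint_left.1 h hD]
    · by_cases hS : c ∈ S <;> simp [hD, hS, hF]
  rw [Finset.prod_congr rfl fun c _ => h1 c, Finset.prod_mul_distrib, Finset.prod_ite_mem,
    Finset.prod_ite_mem, Finset.univ_inter, Finset.univ_inter]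

theorem sum_pairCount {D S : Finset α} (h : Disjoint D S) :
    ∑ c, pairCount D S c = 2 * D.card + S.card := by
  have := prod_pairCount (M := Multiplicative ℕ) h (fun _ k => Multiplicative.ofAdd k)
    (fun _ => rfl)
  have := congrArg Multiplicative.toAdd this
  simpa [toAdd_prod, mul_comm, add_comm] using this

theorem two_pow_mul_sum_pairWords (q : α → ℝ) {n j : ℕ} (hj : 2 * j ≤ n) :
    2 ^ j * ∑ z ∈ pairWords α n j, ∏ i, q (z i)
      = n.factorial * ∑ D ∈ Finset.univ.powersetCard j,
          (∏ c ∈ D, q c ^ 2) * elemSum q Dᶜ (n - 2 * j) := by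
  set T : Finset (Σ _ : Finset α, Finset α) :=
    ((Finset.univ : Finset α).powersetCard j).sigma fun D => Dᶜ.powersetCard (n - 2 * j) with hT
  let g : (Fin n → α) → (Σ _ : Finset α, Finset α) := fun z =>
    ⟨Finset.univ.filter fun c => letterCount z c = 2,
      Finset.univ.filter fun c => letterCount z c = 1⟩
  have hmaps : ∀ z ∈ pairWords α n j, g z ∈ T := by
    intro z hz
    rw [mem_pairWords] at hz
    rw [hT, Finset.mem_sigma, Finset.mem_powersetCard, Finset.mem_powersetCard]
    refine ⟨⟨Finset.subset_univ _, hz.2⟩, ?_, ?_⟩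
    · intro c
      simp only [g, Finset.mem_filter, Finset.mem_univ, true_and, Finset.mem_compl]
      omega
    · have := hz.card_one (sum_letterCount z)
      simp only [g]
      omega
  have hfib : ∀ p ∈ T, 2 ^ j * ∑ z ∈ pairWords α n j with g z = p, ∏ i, q (z i)
      = n.factorial * ((∏ c ∈ p.1, q c ^ 2) * ∏ c ∈ p.2, q c) := by
    rintro ⟨D, S⟩ hp
    rw [hT, Finset.mem_sigma, Finset.mem_powersetCard, Finset.mem_powersetCard] at hp
    obtain ⟨⟨-, hD⟩, hSD, hS⟩ := hp
    simp only at hD hSD hS ⊢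
    have hdis : Disjoint D S := by
      rw [Finset.disjoint_left]
      intro c hc hc'
      exact Finset.mem_compl.1 (hSD hc') hc
    have hset : ((pairWords α n j).filter fun z => g z = ⟨D, S⟩)
        = Finset.univ.filter fun z : Fin n → α => letterCount z = pairCount D S := by
      ext z
      simp only [Finset.mem_filter, Finset.mem_univ, true_and, mem_pairWords]
      constructor
      · rintro ⟨hz, hg⟩
        simp only [g, Sigma.mk.injEq, heq_eq_eq] at hg
        obtain ⟨rfl, rfl⟩ := hg
        funext c
        have := hz.1 c
        simp only [pairCount, Finset.mem_filter, Finset.mem_univ, true_and]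
        split_ifs <;> omega
      · intro hz
        have h2 : (Finset.univ.filter fun c => letterCount z c = 2) = D := by
          ext c
          simp only [hz, pairCount, Finset.mem_filter, Finset.mem_univ, true_and]
          split_ifs <;> simp_all
        have h1 : (Finset.univ.filter fun c => letterCount z c = 1) = S := by
          ext c
          have : c ∈ D → c ∉ S := fun h => Finset.disjoint_left.1 hdis h
          simp only [hz, pairCount, Finset.mem_filter, Finset.mem_univ, true_and]
          split_ifs <;> simp_all
        refine ⟨⟨fun c => ?_, by rw [h2, hD]⟩, ?_⟩
        · rw [hz]
          unfold pairCount
          split_ifs <;> omega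
        · simp only [g, h1, h2]
    have hval : ∀ z ∈ Finset.univ.filter fun z : Fin n → α => letterCount z = pairCount D S,
        ∏ i, q (z i) = (∏ c ∈ D, q c ^ 2) * ∏ c ∈ S, q c := by
      intro z hz
      rw [prod_word_eq, (Finset.mem_filter.1 hz).2,
        prod_pairCount hdis (fun c k => q c ^ k) fun _ => pow_zero _]
      simp
    have hcard := card_letterCount_eq_mul_prod_factorial (n := n) (pairCount D S)
      (by rw [sum_pairCount hdis, hD, hS]; omega)
    rw [prod_pairCount hdis (fun _ k => k.factorial) fun _ => rfl] at hcard
    simp only [Nat.factorial_two, Finset.prod_const, Nat.factorial_one, one_pow, mul_one, hD]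
      at hcard
    rw [hset, Finset.sum_congr rfl hval, Finset.sum_const, nsmul_eq_mul, ← hcard]
    push_cast
    ring
  rw [← Finset.sum_fiberwise_of_maps_to hmaps, Finset.mul_sum, Finset.sum_congr rfl hfib,
    ← Finset.mul_sum, hT, Finset.sum_sigma]
  congr 1
  refine Finset.sum_congr rfl fun D _ => ?_
  rw [elemSum, Finset.mul_sum]

/-- Lower bound on the probability of `pairWords`: a choice of `j` repeated letters, each
contributing about `K = ∑ q ^ 2`, and a birthday problem for the remaining `n - 2 j` letters. -/
theorem sum_pairWords_ge {q : α → ℝ} (hq : ∀ c, 0 ≤ q c) (hq1 : ∑ c, q c = 1) {M K : ℝ}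
    (hM : ∀ c, q c ≤ M) (hK : ∑ c, q c ^ 2 = K) {n j : ℕ} (hj : 2 * j ≤ n)
    (hjM : j * M < 1) (hjK : j * M ^ 2 ≤ K) (hx : j * M + n * K / (1 - j * M) ≤ 1) :
    n.factorial * ((K - j * M ^ 2) ^ j *
        ∏ i ∈ Finset.range (n - 2 * j), (1 - (j * M + i * K / (1 - j * M))))
      ≤ 2 ^ j * j.factorial * (n - 2 * j).factorial *
          ∑ z ∈ pairWords α n j, ∏ i, q (z i) := by
  have hK0 : 0 < K := by
    rw [← hK]
    obtain ⟨c, -, hc⟩ : ∃ c ∈ Finset.univ, q c ≠ 0 :=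
      Finset.exists_ne_zero_of_sum_ne_zero (by rw [hq1]; exact one_ne_zero)
    exact Finset.sum_pos' (fun c _ => sq_nonneg _)
      ⟨c, Finset.mem_univ c, by positivity⟩
  set P := ∏ i ∈ Finset.range (n - 2 * j), (1 - (j * M + i * K / (1 - j * M))) with hP
  have hfac : ∀ i : ℕ, i < n → 0 ≤ 1 - (j * M + i * K / (1 - j * M)) := by
    intro i hi
    have : (i : ℝ) * K / (1 - j * M) ≤ n * K / (1 - j * M) := by
      have : (0 : ℝ) < 1 - j * M := by linarith
      have : (i : ℝ) ≤ n := by exact_mod_cast hi.le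
      gcongr
    linarith
  have hP0 : 0 ≤ P := Finset.prod_nonneg fun i hi =>
    hfac i (by have := Finset.mem_range.1 hi; omega)
  have hone : ∀ D ∈ (Finset.univ : Finset α).powersetCard j,
      P ≤ (n - 2 * j).factorial * elemSum q Dᶜ (n - 2 * j) := by
    intro D hD
    have hcard := (Finset.mem_powersetCard.1 hD).2
    have hsum : 1 - j * M ≤ ∑ c ∈ Dᶜ, q c := by
      have h1 := Finset.sum_add_sum_compl D q
      have h2 : ∑ c ∈ D, q c ≤ j * M := by
        rw [← hcard, ← nsmul_eq_mul]
        exact Finset.sum_le_card_nsmul _ _ _ fun c _ => hM c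
      linarith
    have hsq : ∑ c ∈ Dᶜ, q c ^ 2 ≤ K := by
      rw [← hK]
      exact Finset.sum_le_sum_of_subset_of_nonneg (Finset.subset_univ _) fun _ _ _ => sq_nonneg _
    have := factorial_mul_elemSum_ge hq (by linarith) hsum hsq (n - 2 * j) fun i hi => by
      have := hfac i (by omega)
      linarith
    refine le_trans (le_of_eq ?_) this
    rw [hP]
    refine Finset.prod_congr rfl fun i _ => ?_
    ring
  have hpairs : (K - j * M ^ 2) ^ j
      ≤ j.factorial * ∑ D ∈ (Finset.univ : Finset α).powersetCard j, ∏ c ∈ D, q c ^ 2 := by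
    have hB : ∑ c, (q c ^ 2) ^ 2 ≤ M ^ 2 * K := by
      rw [← hK, Finset.mul_sum]
      refine Finset.sum_le_sum fun c _ => ?_
      rw [sq (q c ^ 2)]
      exact mul_le_mul_of_nonneg_right (pow_le_pow_left₀ (hq c) (hM c) 2) (sq_nonneg _)
    have hterm : ∀ i : ℕ, K - i * (M ^ 2 * K) / K = K - i * M ^ 2 := by
      intro i
      field_simp
    have hmono : ∀ i : ℕ, i < j → K - j * M ^ 2 ≤ K - i * M ^ 2 := by
      intro i hi
      have : (i : ℝ) ≤ j := by exact_mod_cast hi.le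
      have := mul_le_mul_of_nonneg_right this (sq_nonneg M)
      linarith
    have := factorial_mul_elemSum_ge (y := fun c => q c ^ 2) (fun c => sq_nonneg _) hK0
      (s := Finset.univ) hK.ge hB j fun i hi => by
        rw [hterm]
        linarith [hmono i hi]
    refine le_trans ?_ this
    rw [← Finset.card_range j, ← Finset.prod_const, Finset.card_range]
    refine Finset.prod_le_prod (fun i _ => by linarith) fun i hi => ?_
    rw [hterm]
    exact hmono i (Finset.mem_range.1 hi)
  have hall : (∑ D ∈ (Finset.univ : Finset α).powersetCard j, ∏ c ∈ D, q c ^ 2) * P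
      ≤ (n - 2 * j).factorial * ∑ D ∈ (Finset.univ : Finset α).powersetCard j,
        (∏ c ∈ D, q c ^ 2) * elemSum q Dᶜ (n - 2 * j) := by
    rw [Finset.sum_mul, Finset.mul_sum]
    refine Finset.sum_le_sum fun D hD => ?_
    have := mul_le_mul_of_nonneg_left (hone D hD)
      (Finset.prod_nonneg fun c (_ : c ∈ D) => sq_nonneg (q c))
    linarith
  have heq := two_pow_mul_sum_pairWords q hj
  calc (n.factorial : ℝ) * ((K - j * M ^ 2) ^ j * P)
      ≤ n.factorial * (j.factorial *
          ((∑ D ∈ (Finset.univ : Finset α).powersetCard j, ∏ c ∈ D, q c ^ 2) * P)) := by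
        refine mul_le_mul_of_nonneg_left ?_ (Nat.cast_nonneg _)
        rw [← mul_assoc]
        exact mul_le_mul_of_nonneg_right hpairs hP0
    _ ≤ n.factorial * (j.factorial * ((n - 2 * j).factorial *
          ∑ D ∈ (Finset.univ : Finset α).powersetCard j,
            (∏ c ∈ D, q c ^ 2) * elemSum q Dᶜ (n - 2 * j))) := by
        gcongr
    _ = j.factorial * (n - 2 * j).factorial *
          (2 ^ j * ∑ z ∈ pairWords α n j, ∏ i, q (z i)) := by
        rw [heq]
        ring
    _ = _ := by ring

end PairProb

/-! ### Asymptotics of the probability of `pairWords` -/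

theorem exp_neg_sum_div_le_prod_one_sub {N : ℕ} {y : ℕ → ℝ} {x : ℝ} (hx : x < 1)
    (hy0 : ∀ i < N, 0 ≤ y i) (hy : ∀ i < N, y i ≤ x) :
    Real.exp (-(∑ i ∈ Finset.range N, y i) / (1 - x)) ≤ ∏ i ∈ Finset.range N, (1 - y i) := by
  rw [neg_div, Finset.sum_div, ← Finset.sum_neg_distrib, Real.exp_sum]
  refine Finset.prod_le_prod (fun _ _ => (Real.exp_pos _).le) fun i hi => ?_
  have hi := Finset.mem_range.1 hi
  have h1 : 0 < 1 - y i := by linarith [hy i hi]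
  rw [← Real.le_log_iff_exp_le h1]
  refine le_trans ?_ (Real.one_sub_inv_le_log_of_pos h1)
  have h2 : 1 - (1 - y i)⁻¹ = -(y i / (1 - y i)) := by
    field_simp
    ring
  rw [h2, neg_le_neg_iff]
  exact div_le_div_of_nonneg_left (hy0 i hi) (by linarith) (by linarith [hy i hi])

theorem tendsto_log_factorial_remainder :
    Tendsto (fun j : ℕ => Real.log j.factorial / j - Real.log j + 1) atTop (𝓝 0) := by
  have h1 : Tendsto (fun j : ℕ => Real.log (Stirling.stirlingSeq j) / j) atTop (𝓝 0) :=
    (Stirling.tendsto_stirlingSeq_sqrt_pi.log (by positivity)).div_atTop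
      tendsto_natCast_atTop_atTop
  have h2 : Tendsto (fun j : ℕ => Real.log (2 * j) / (2 * j)) atTop (𝓝 0) := by
    have := Real.isLittleO_log_id_atTop.tendsto_div_nhds_zero
    exact this.comp (tendsto_natCast_atTop_atTop.const_mul_atTop (two_pos (α := ℝ)))
  have h3 := h1.add h2
  rw [add_zero] at h3
  refine h3.congr' ?_
  filter_upwards [eventually_gt_atTop 0] with j hj
  have hj' : (0 : ℝ) < j := by exact_mod_cast hj
  rw [Stirling.log_stirlingSeq_formula, Real.log_div hj'.ne' (Real.exp_ne_zero _), Real.log_exp]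
  field_simp
  ring

/-- `sum_pairWords_ge` in exponential form, with `s` the error of Stirling's approximation to
`log j!`. -/
theorem exp_le_sum_pairWords {α : Type*} [Fintype α] [DecidableEq α] {q : α → ℝ}
    (hq : ∀ c, 0 ≤ q c) (hq1 : ∑ c, q c = 1) {M K s : ℝ}
    (hM : ∀ c, q c ≤ M) (hK : ∑ c, q c ^ 2 = K) {n j : ℕ} (hj0 : 0 < j) (hj : 2 * j < n)
    (hs : s = Real.log j.factorial / j - Real.log j + 1)
    (hjM : j * M < 1) (hjK : j * M ^ 2 < K) (hx : j * M + n * K / (1 - j * M) < 1) :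
    Real.exp (j * (Real.log ((n - 2 * j) ^ 2 * (K - j * M ^ 2) / (2 * j)) + 1 - s)
        - (n * (j * M) + n ^ 2 / 2 * (K / (1 - j * M))) / (1 - (j * M + n * K / (1 - j * M))))
      ≤ ∑ z ∈ pairWords α n j, ∏ i, q (z i) := by
  have hmain := sum_pairWords_ge hq hq1 hM hK hj.le hjM hjK.le hx.le
  have hM0 : 0 ≤ M := by
    by_contra! h
    have : ∑ c, q c ≤ ∑ _c : α, (0 : ℝ) := Finset.sum_le_sum fun c _ => (hM c).trans h.le
    simp [hq1] at this
    linarith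
  have hK0 : 0 ≤ K := hK ▸ Finset.sum_nonneg fun c _ => sq_nonneg (q c)
  have hj0' : (0 : ℝ) < j := by exact_mod_cast hj0
  have hjn : 2 * (j : ℝ) < n := by exact_mod_cast hj
  have hT : 0 < 1 - j * M := by linarith
  have hprod := exp_neg_sum_div_le_prod_one_sub (N := n - 2 * j)
    (y := fun i => j * M + i * K / (1 - j * M)) hx (fun i _ => by positivity) (fun i hi => by
      have : (i : ℝ) ≤ n := by exact_mod_cast (by omega : i ≤ n)
      gcongr)
  have hsum : ∑ i ∈ Finset.range (n - 2 * j), (j * M + i * K / (1 - j * M))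
      ≤ n * (j * M) + n ^ 2 / 2 * (K / (1 - j * M)) := by
    have h1 : ((n - 2 * j : ℕ) : ℝ) ≤ n := by exact_mod_cast Nat.sub_le _ _
    have h2 : ∑ i ∈ Finset.range (n - 2 * j), (i : ℝ) ≤ n ^ 2 / 2 := by
      have hg : ∀ N : ℕ, ∑ i ∈ Finset.range N, (i : ℝ) ≤ (N : ℝ) ^ 2 / 2 := by
        intro N
        induction N with
        | zero => simp
        | succ N ih =>
          rw [Finset.sum_range_succ]
          push_cast
          linarith
      refine (hg _).trans ?_
      gcongr
    rw [Finset.sum_add_distrib, Finset.sum_const, Finset.card_range, nsmul_eq_mul]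
    have h3 : ∑ i ∈ Finset.range (n - 2 * j), (i : ℝ) * K / (1 - j * M)
        = (∑ i ∈ Finset.range (n - 2 * j), (i : ℝ)) * (K / (1 - j * M)) := by
      rw [Finset.sum_mul]
      exact Finset.sum_congr rfl fun i _ => mul_div_assoc _ _ _
    rw [h3]
    gcongr
  set P := ∏ i ∈ Finset.range (n - 2 * j), (1 - (j * M + i * K / (1 - j * M)))
  set x := j * M + n * K / (1 - j * M)
  set E := n * (j * M) + (n : ℝ) ^ 2 / 2 * (K / (1 - j * M))
  have hP : Real.exp (-E / (1 - x)) ≤ P := by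
    refine le_trans (Real.exp_le_exp.2 ?_) hprod
    exact div_le_div_of_nonneg_right (neg_le_neg hsum) (by linarith)
  have hdesc : ((n : ℝ) - 2 * j) ^ (2 * j) * (n - 2 * j).factorial ≤ n.factorial := by
    have h1 : (n - 2 * j) ^ (2 * j) ≤ n.descFactorial (2 * j) :=
      (Nat.pow_le_pow_left (by omega) _).trans (Nat.pow_sub_le_descFactorial n (2 * j))
    have h2 := Nat.factorial_mul_descFactorial hj.le
    have h3 : (n - 2 * j) ^ (2 * j) * (n - 2 * j).factorial ≤ n.factorial := by
      rw [← h2, mul_comm]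
      exact Nat.mul_le_mul_left _ h1
    have h4 : ((n - 2 * j : ℕ) : ℝ) = (n : ℝ) - 2 * j := by
      rw [Nat.cast_sub hj.le]
      push_cast
      ring
    rw [← h4]
    exact_mod_cast h3
  have hfac : (j.factorial : ℝ) = Real.exp (j * (Real.log j - 1 + s)) := by
    rw [hs]
    have : (j : ℝ) * (Real.log j - 1 + (Real.log j.factorial / j - Real.log j + 1))
        = Real.log j.factorial := by
      field_simp
      ring
    rw [this, Real.exp_log (by exact_mod_cast j.factorial_pos)]
  have hB : 0 < K - j * M ^ 2 := by linarith
  have hA : 0 < (n : ℝ) - 2 * j := by linarith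
  have hexp : Real.exp (j * (Real.log ((n - 2 * j) ^ 2 * (K - j * M ^ 2) / (2 * j)) + 1 - s)
      - E / (1 - x)) * (2 ^ j * j.factorial)
      = ((n : ℝ) - 2 * j) ^ (2 * j) * (K - j * M ^ 2) ^ j * Real.exp (-E / (1 - x)) := by
    have h1 : ∀ y : ℝ, 0 < y → y ^ j = Real.exp (j * Real.log y) := fun y hy => by
      rw [Real.exp_nat_mul, Real.exp_log hy]
    rw [hfac, pow_mul, h1 2 two_pos, h1 _ (pow_pos hA 2), h1 _ hB, ← Real.exp_add, ← Real.exp_add,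
      ← Real.exp_add, ← Real.exp_add, Real.log_div (by positivity) (by positivity),
      Real.log_mul (by positivity) (by positivity), Real.log_mul (by positivity) hj0'.ne']
    congr 1
    ring
  have hC : (0 : ℝ) < 2 ^ j * j.factorial * (n - 2 * j).factorial := by positivity
  refine le_of_mul_le_mul_left (le_trans ?_ hmain) hC
  calc 2 ^ j * j.factorial * (n - 2 * j).factorial * Real.exp
        (j * (Real.log ((n - 2 * j) ^ 2 * (K - j * M ^ 2) / (2 * j)) + 1 - s) - E / (1 - x))
      = (((n : ℝ) - 2 * j) ^ (2 * j) * (n - 2 * j).factorial) *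
          ((K - j * M ^ 2) ^ j * Real.exp (-E / (1 - x))) := by
        linear_combination ((n - 2 * j).factorial : ℝ) * hexp
    _ ≤ n.factorial * ((K - j * M ^ 2) ^ j * P) := by
        gcongr

/-- The large-deviation rate at `t` of the Poisson distribution: a Poisson variable with mean
`κ r / 2` is close to `t r` with probability `exp (-r * poissonRate κ t + o(r))`. -/
noncomputable def poissonRate (κ t : ℝ) : ℝ :=
  κ / 2 - t * (Real.log (κ / (2 * t)) + 1)

/-- The probability of `j ≈ t r` repeated letters, where `r = n ^ 2 / m`, decays at most at the
Poisson rate, if the p.m.f.s are comparable to the uniform ones and `m ∑ q ^ 2` tends to `κ`. -/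
theorem eventually_exp_le_sum_pairWords {m j : ℕ → ℕ} {q : ∀ n, Fin (m n) → ℝ} {a κ t δ : ℝ}
    (hκ : 0 < κ) (ht : 0 < t) (hδ : 0 < δ)
    (hv : Tendsto (fun n : ℕ => (n : ℝ) / m n) atTop (𝓝 0))
    (hr : Tendsto (fun n : ℕ => (n : ℝ) ^ 2 / m n) atTop atTop)
    (hq : ∀ᶠ n in atTop, (∀ c, 0 ≤ q n c) ∧ ∑ c, q n c = 1 ∧ ∀ c, q n c ≤ a / m n)
    (hk : Tendsto (fun n => m n * ∑ c, q n c ^ 2) atTop (𝓝 κ))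
    (hj : Tendsto (fun n : ℕ => (j n : ℝ) / ((n : ℝ) ^ 2 / m n)) atTop (𝓝 t)) :
    ∀ᶠ n : ℕ in atTop, Real.exp (-((n : ℝ) ^ 2 / m n * (poissonRate κ t + δ)))
      ≤ ∑ z ∈ pairWords (Fin (m n)) n (j n), ∏ i, q n (z i) := by
  set u : ℕ → ℝ := fun n => (j n : ℝ) / ((n : ℝ) ^ 2 / m n) with hu
  set v : ℕ → ℝ := fun n => (n : ℝ) / m n with hvdef
  set k : ℕ → ℝ := fun n => m n * ∑ c, q n c ^ 2 with hkdef
  set s : ℕ → ℝ := fun n => Real.log (j n).factorial / j n - Real.log (j n) + 1 with hsdef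
  have hjr : Tendsto (fun n => (j n : ℝ)) atTop atTop := by
    refine (hj.pos_mul_atTop ht hr).congr' ?_
    filter_upwards [hr.eventually_gt_atTop 0] with n hn
    exact div_mul_cancel₀ _ hn.ne'
  have hs : Tendsto s atTop (𝓝 0) :=
    tendsto_log_factorial_remainder.comp (tendsto_natCast_atTop_iff.1 hjr)
  have huv : Tendsto (fun n => u n * v n) atTop (𝓝 0) := by simpa using hj.mul hv
  have huv2 : Tendsto (fun n => u n * v n * v n) atTop (𝓝 0) := by simpa using huv.mul hv
  have hT : Tendsto (fun n => 1 - a * (u n * v n * v n)) atTop (𝓝 1) := by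
    simpa using (huv2.const_mul a).const_sub 1
  have hx : Tendsto (fun n => a * (u n * v n * v n) + v n * k n / (1 - a * (u n * v n * v n)))
      atTop (𝓝 0) := by
    simpa using (huv2.const_mul a).add ((hv.mul hk).div hT one_ne_zero)
  have hB : Tendsto (fun n => k n - a ^ 2 * (u n * v n * v n)) atTop (𝓝 κ) := by
    simpa using hk.sub (huv2.const_mul (a ^ 2))
  have hlog : Tendsto (fun n => Real.log ((1 - 2 * (u n * v n)) ^ 2 *
      (k n - a ^ 2 * (u n * v n * v n)) / (2 * u n))) atTop (𝓝 (Real.log (κ / (2 * t)))) := by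
    refine Tendsto.log ?_ (by positivity)
    have := ((((huv.const_mul 2).const_sub 1).pow 2).mul hB).div (hj.const_mul 2)
      (by positivity : 2 * t ≠ 0)
    have h0 : (1 - 2 * 0) ^ 2 * κ / (2 * t) = κ / (2 * t) := by ring
    rwa [h0] at this
  have hE : Tendsto (fun n => (a * (u n * v n) + 1 / 2 * (k n / (1 - a * (u n * v n * v n)))) /
      (1 - (a * (u n * v n * v n) + v n * k n / (1 - a * (u n * v n * v n))))) atTop
      (𝓝 (κ / 2)) := by
    have := ((huv.const_mul a).add ((hk.div hT one_ne_zero).const_mul (1 / 2))).div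
      (hx.const_sub 1) (by norm_num)
    have h0 : (a * 0 + 1 / 2 * (κ / 1)) / (1 - 0) = κ / 2 := by ring
    rwa [h0] at this
  have hF := (hj.mul ((hlog.add_const 1).sub hs)).sub hE
  have hlim : t * (Real.log (κ / (2 * t)) + 1 - 0) - κ / 2 = -poissonRate κ t := by
    rw [poissonRate]
    ring
  rw [hlim] at hF
  have hlt : -(poissonRate κ t + δ) < -poissonRate κ t := by linarith
  filter_upwards [hF.eventually_const_lt hlt, hq, hr.eventually_gt_atTop 0,
    hjr.eventually_gt_atTop 0, hT.eventually_const_lt one_pos, hx.eventually_lt_const one_pos,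
    hB.eventually_const_lt hκ, huv.eventually_lt_const (by norm_num : (0 : ℝ) < 1 / 2),
    eventually_gt_atTop 0] with n hFn hqn hrn hjn hTn hxn hBn huvn hn
  obtain ⟨hq0, hq1, hqM⟩ := hqn
  have hn' : (0 : ℝ) < n := by exact_mod_cast hn
  have hm : (0 : ℝ) < m n := by
    by_contra! h
    have : (m n : ℝ) = 0 := le_antisymm h (Nat.cast_nonneg _)
    simp [this] at hrn
  have e1 : a * (u n * v n * v n) = j n * (a / m n) := by
    simp only [hu, hvdef]
    field_simp
  have e2 : a ^ 2 * (u n * v n * v n) = m n * (j n * (a / m n) ^ 2) := by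
    simp only [hu, hvdef]
    field_simp
  have e3 : v n * k n = n * ∑ c, q n c ^ 2 := by
    simp only [hkdef, hvdef]
    field_simp
  have e4 : u n * v n = j n / n := by
    simp only [hu, hvdef]
    field_simp
  have h1 := exp_le_sum_pairWords hq0 hq1 hqM rfl (by exact_mod_cast hjn)
    (n := n) (j := j n) (by
      rw [e4, div_lt_iff₀ hn'] at huvn
      have : 2 * (j n : ℝ) < n := by linarith
      exact_mod_cast this) rfl
    (by rw [← e1]; linarith)
    (by
      rw [e2] at hBn
      simp only [hkdef] at hBn
      rw [← mul_sub] at hBn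
      linarith [pos_of_mul_pos_right hBn hm.le])
    (by rw [← e1, ← e3]; exact hxn)
  refine le_trans (Real.exp_le_exp.2 ?_) h1
  rw [← mul_neg]
  refine (mul_le_mul_of_nonneg_left hFn.le hrn.le).trans (le_of_eq ?_)
  rw [e1, e2, e3, e4]
  have e5 : (1 - 2 * ((j n : ℝ) / n)) ^ 2 * (k n - m n * (j n * (a / m n) ^ 2)) / (2 * u n)
      = (n - 2 * j n) ^ 2 * (∑ c, q n c ^ 2 - j n * (a / m n) ^ 2) / (2 * j n) := by
    simp only [hu, hkdef]
    field_simp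
  have e6 : (n : ℝ) ^ 2 / m n * u n = j n := by
    simp only [hu]
    field_simp
  have e7 : (n : ℝ) ^ 2 / m n * (a * (j n / n) + 1 / 2 * (k n / (1 - j n * (a / m n))))
      = n * (j n * (a / m n)) + n ^ 2 / 2 * ((∑ c, q n c ^ 2) / (1 - j n * (a / m n))) := by
    simp only [hkdef]
    rw [mul_add]
    congr 1
    · field_simp
    · generalize 1 - (j n : ℝ) * (a / m n) = T
      field_simp
  rw [e5, mul_sub, ← mul_assoc, e6, ← mul_div_assoc, e7]

/-! ### The number of repeated letters under the uniform distribution -/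

section Uniform

variable {α : Type*} [Fintype α] [DecidableEq α]

/-- The number of pairs of positions of a word that carry the same letter. -/
def pairNumber {n : ℕ} (z : Fin n → α) : ℕ := ∑ c, (letterCount z c).choose 2

/-- The number of triples of positions of a word that carry the same letter. -/
def tripleNumber {n : ℕ} (z : Fin n → α) : ℕ := ∑ c, (letterCount z c).choose 3

theorem sum_choose_letterCount_cons {n : ℕ} (a : α) (z : Fin n → α) (u : ℕ) :
    ∑ c, (letterCount (Fin.cons a z : Fin (n + 1) → α) c).choose (u + 1)
      = ∑ c, (letterCount z c).choose (u + 1) + (letterCount z a).choose u := by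
  rw [letterCount_cons, ← Finset.sum_erase_add _ _ (Finset.mem_univ a),
    ← Finset.sum_erase_add Finset.univ (fun c => (letterCount z c).choose (u + 1))
      (Finset.mem_univ a), Pi.add_apply, Pi.single_eq_same, Nat.choose_succ_succ, add_assoc,
    add_comm ((letterCount z a).choose u)]
  congr 1
  refine Finset.sum_congr rfl fun c hc => ?_
  rw [Pi.add_apply, Pi.single_eq_of_ne (Finset.ne_of_mem_erase hc), add_zero]

theorem sum_pairNumber (n : ℕ) :
    (Fintype.card α : ℝ) * ∑ z : Fin n → α, (pairNumber z : ℝ)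
      = n * (n - 1) / 2 * (Fintype.card α) ^ n := by
  induction n with
  | zero => simp [pairNumber, letterCount]
  | succ n ih =>
    have h : ∀ (a : α) (z : Fin n → α),
        (pairNumber (Fin.cons a z : Fin (n + 1) → α) : ℝ) = pairNumber z + letterCount z a := by
      intro a z
      have := sum_choose_letterCount_cons a z 1
      rw [Nat.choose_one_right] at this
      unfold pairNumber
      exact_mod_cast this
    have hz : ∀ z : Fin n → α, ∑ a, (letterCount z a : ℝ) = n := fun z => by
      exact_mod_cast sum_letterCount z
    rw [sum_word_cons, Finset.sum_comm]
    simp only [h, Finset.sum_add_distrib, hz, Finset.sum_const, Finset.card_univ, nsmul_eq_mul,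
      ← Finset.mul_sum, Fintype.card_fun, Fintype.card_fin]
    rw [ih]
    push_cast
    ring

theorem sum_tripleNumber_le (n : ℕ) :
    (Fintype.card α : ℝ) ^ 2 * ∑ z : Fin n → α, (tripleNumber z : ℝ)
      ≤ n ^ 3 / 6 * (Fintype.card α) ^ n := by
  have key : (Fintype.card α : ℝ) ^ 2 * ∑ z : Fin n → α, (tripleNumber z : ℝ)
      = n * (n - 1) * (n - 2) / 6 * (Fintype.card α) ^ n := by
    induction n with
    | zero => simp [tripleNumber, letterCount]
    | succ n ih =>
      have h : ∀ (a : α) (z : Fin n → α), (tripleNumber (Fin.cons a z : Fin (n + 1) → α) : ℝ)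
          = tripleNumber z + (letterCount z a).choose 2 := by
        intro a z
        have := sum_choose_letterCount_cons a z 2
        unfold tripleNumber
        exact_mod_cast this
      have hz : ∀ z : Fin n → α, ∑ a, ((letterCount z a).choose 2 : ℝ) = pairNumber z := fun z => by
        simp [pairNumber]
      have hp := sum_pairNumber (α := α) n
      rw [sum_word_cons, Finset.sum_comm]
      simp only [h, Finset.sum_add_distrib, hz, Finset.sum_const, Finset.card_univ, nsmul_eq_mul,
        ← Finset.mul_sum]
      push_cast
      linear_combination (Fintype.card α : ℝ) * ih + (Fintype.card α : ℝ) * hp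
  rw [key]
  refine mul_le_mul_of_nonneg_right ?_ (by positivity)
  have : (n : ℝ) * (n - 1) * (n - 2) ≤ n ^ 3 := by
    rcases Nat.eq_zero_or_pos n with rfl | hn
    · simp
    · have : (1 : ℝ) ≤ n := by exact_mod_cast hn
      nlinarith
  linarith

/-- The number of pairs, centred at its mean, is a martingale in the length of the word. So its
variance adds up along the word, to at most `n * (n - 1) / 2 / card α`. -/
theorem sum_sq_pairNumber_le (n : ℕ) (hα : 0 < Fintype.card α) :
    (Fintype.card α : ℝ) *
        ∑ z : Fin n → α, ((pairNumber z : ℝ) - n * (n - 1) / 2 / Fintype.card α) ^ 2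
      ≤ n * (n - 1) / 2 * (Fintype.card α) ^ n := by
  have hα' : (0 : ℝ) < Fintype.card α := by exact_mod_cast hα
  induction n with
  | zero => simp [pairNumber, letterCount]
  | succ n ih =>
    have h : ∀ (a : α) (z : Fin n → α),
        (pairNumber (Fin.cons a z : Fin (n + 1) → α) : ℝ) = pairNumber z + letterCount z a := by
      intro a z
      have := sum_choose_letterCount_cons a z 1
      rw [Nat.choose_one_right] at this
      unfold pairNumber
      exact_mod_cast this
    have hz : ∀ z : Fin n → α, ∑ a, (letterCount z a : ℝ) = n := fun z => by
      exact_mod_cast sum_letterCount z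
    have hz2 : ∀ z : Fin n → α, ∑ a, (letterCount z a : ℝ) ^ 2 = 2 * pairNumber z + n := by
      intro z
      have : ∀ a, (letterCount z a : ℝ) ^ 2
          = 2 * ((letterCount z a).choose 2 : ℝ) + letterCount z a := by
        intro a
        rw [Nat.cast_choose_two]
        ring
      rw [Finset.sum_congr rfl fun a _ => this a, Finset.sum_add_distrib, ← Finset.mul_sum, hz]
      simp [pairNumber]
    set N : ℝ := (Fintype.card α : ℝ) with hN
    set μ : ℝ := n * (n - 1) / 2 / N with hμ
    have hμ' : ((n + 1 : ℕ) : ℝ) * ((n + 1 : ℕ) - 1) / 2 / N = μ + n / N := by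
      rw [hμ]
      push_cast
      field_simp
      ring
    have hstep : ∀ z : Fin n → α, ∑ a, ((pairNumber (Fin.cons a z : Fin (n + 1) → α) : ℝ)
        - ((n + 1 : ℕ) : ℝ) * ((n + 1 : ℕ) - 1) / 2 / N) ^ 2
        = N * (pairNumber z - μ) ^ 2 + (2 * pairNumber z + n - n ^ 2 / N) := by
      intro z
      have : ∀ a, ((pairNumber (Fin.cons a z : Fin (n + 1) → α) : ℝ)
          - ((n + 1 : ℕ) : ℝ) * ((n + 1 : ℕ) - 1) / 2 / N) ^ 2
          = ((pairNumber z - μ) - n / N) ^ 2 + 2 * ((pairNumber z - μ) - n / N) * letterCount z a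
            + (letterCount z a : ℝ) ^ 2 := by
        intro a
        rw [h, hμ']
        ring
      rw [Finset.sum_congr rfl fun a _ => this a, Finset.sum_add_distrib, Finset.sum_add_distrib,
        ← Finset.mul_sum, hz, hz2, Finset.sum_const, Finset.card_univ, nsmul_eq_mul, ← hN]
      field_simp
      ring
    have hp := sum_pairNumber (α := α) n
    rw [sum_word_cons, Finset.sum_comm, Finset.sum_congr rfl fun z _ => hstep z,
      Finset.sum_add_distrib, ← Finset.mul_sum, Finset.sum_sub_distrib, Finset.sum_add_distrib,
      ← Finset.mul_sum, Finset.sum_const, Finset.sum_const, Finset.card_univ, Fintype.card_fun,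
      Fintype.card_fin, nsmul_eq_mul, nsmul_eq_mul]
    rw [← hN] at hp
    push_cast
    rw [← hN]
    have hcancel : N * (N ^ n * ((n : ℝ) ^ 2 / N)) = N ^ n * n ^ 2 := by field_simp
    have hpos : 0 ≤ N ^ n * (n : ℝ) := by positivity
    have := mul_le_mul_of_nonneg_left ih hα'.le
    calc _ = N * (N * ∑ z : Fin n → α, ((pairNumber z : ℝ) - μ) ^ 2)
          + (2 * (N * ∑ z : Fin n → α, (pairNumber z : ℝ)) + N * N ^ n * n
            - N * (N ^ n * ((n : ℝ) ^ 2 / N))) := by ring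
      _ ≤ N * (n * (n - 1) / 2 * N ^ n)
          + (2 * (n * (n - 1) / 2 * N ^ n) + N * N ^ n * n - N ^ n * n ^ 2) := by
        rw [hp, hcancel]
        linarith
      _ ≤ _ := by
        rw [pow_succ N n]
        linarith

theorem pairNumber_le {n : ℕ} (z : Fin n → α) :
    pairNumber z ≤ (Finset.univ.filter fun c => 2 ≤ letterCount z c).card + 2 * tripleNumber z := by
  rw [pairNumber, tripleNumber, Finset.card_filter, Finset.mul_sum, ← Finset.sum_add_distrib]
  refine Finset.sum_le_sum fun c _ => ?_
  generalize letterCount z c = k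
  rcases k with _ | _ | k
  · simp
  · simp
  rw [if_pos (by omega)]
  induction k with
  | zero => simp
  | succ k ih =>
    have h1 : (k + 1 + 2).choose 2 = (k + 2).choose 1 + (k + 2).choose 2 :=
      Nat.choose_succ_succ _ _
    have h2 : (k + 1 + 2).choose 3 = (k + 2).choose 2 + (k + 2).choose 3 :=
      Nat.choose_succ_succ _ _
    have h3 : (k + 2).choose 2 = (k + 1).choose 1 + (k + 1).choose 2 :=
      Nat.choose_succ_succ _ _
    rw [Nat.choose_one_right] at h1 h3
    have ih' := ih
    simp only [add_assoc, Nat.reduceAdd] at *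
    omega

/-- Chebyshev's and Markov's inequalities for the numbers of pairs and triples. -/
theorem card_compl_repeatWords_le {n j : ℕ} (hα : 0 < Fintype.card α) {x : ℝ} (hx : 0 < x)
    (hj : j + 2 * x ≤ n * (n - 1) / 2 / Fintype.card α) :
    ((repeatWords α n j)ᶜ.card : ℝ) ≤ (n ^ 2 / 2 / Fintype.card α / x ^ 2
      + n ^ 3 / 3 / (Fintype.card α) ^ 2 / x) * (Fintype.card α) ^ n := by
  have hα' : (0 : ℝ) < Fintype.card α := by exact_mod_cast hα
  set N : ℝ := (Fintype.card α : ℝ)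
  set μ : ℝ := n * (n - 1) / 2 / N with hμ
  have hpt : ∀ z ∈ (repeatWords α n j)ᶜ,
      (1 : ℝ) ≤ ((pairNumber z : ℝ) - μ) ^ 2 / x ^ 2 + 2 * tripleNumber z / x := by
    intro z hz
    rw [Finset.mem_compl, mem_repeatWords, not_le] at hz
    have h1 := pairNumber_le z
    have h2 : (pairNumber z : ℝ) ≤ j + 2 * tripleNumber z := by
      have : pairNumber z ≤ j + 2 * tripleNumber z := by omega
      exact_mod_cast this
    have h3 : 0 ≤ ((pairNumber z : ℝ) - μ) ^ 2 / x ^ 2 := by positivity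
    have h4 : 0 ≤ 2 * (tripleNumber z : ℝ) / x := by positivity
    by_cases ht : x ≤ 2 * tripleNumber z
    · have : 1 ≤ 2 * (tripleNumber z : ℝ) / x := by rwa [one_le_div hx]
      linarith
    · have h5 : x ≤ μ - pairNumber z := by linarith
      have : 1 ≤ ((pairNumber z : ℝ) - μ) ^ 2 / x ^ 2 := by
        rw [one_le_div (by positivity), sub_sq_comm]
        exact pow_le_pow_left₀ hx.le h5 2
      linarith
  have h1 : ((repeatWords α n j)ᶜ.card : ℝ)
      ≤ ∑ z : Fin n → α, (((pairNumber z : ℝ) - μ) ^ 2 / x ^ 2 + 2 * tripleNumber z / x) := by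
    rw [Finset.card_eq_sum_ones, Nat.cast_sum]
    push_cast
    refine (Finset.sum_le_sum hpt).trans
      (Finset.sum_le_sum_of_subset_of_nonneg (Finset.subset_univ _) fun z _ _ => by positivity)
  refine h1.trans ?_
  rw [Finset.sum_add_distrib, ← Finset.sum_div, ← Finset.sum_div, ← Finset.mul_sum, add_mul]
  have hv := sum_sq_pairNumber_le (α := α) n hα
  have ht := sum_tripleNumber_le (α := α) n
  have hv' : ∑ z : Fin n → α, ((pairNumber z : ℝ) - μ) ^ 2 ≤ n ^ 2 / 2 / N * N ^ n := by
    have h0 : N * ∑ z : Fin n → α, ((pairNumber z : ℝ) - μ) ^ 2 ≤ n ^ 2 / 2 * N ^ n := by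
      refine hv.trans (mul_le_mul_of_nonneg_right ?_ (by positivity))
      have : (0 : ℝ) ≤ n := Nat.cast_nonneg n
      linarith
    rw [div_mul_eq_mul_div, le_div_iff₀ hα']
    linarith
  have ht' : ∑ z : Fin n → α, (tripleNumber z : ℝ) ≤ n ^ 3 / 6 / N ^ 2 * N ^ n := by
    rw [div_mul_eq_mul_div, le_div_iff₀ (by positivity)]
    linarith
  refine add_le_add ?_ ?_
  · calc _ ≤ (n ^ 2 / 2 / N * N ^ n) / x ^ 2 := by gcongr
      _ = _ := by ring
  · calc _ ≤ (2 * (n ^ 3 / 6 / N ^ 2 * N ^ n)) / x := by gcongr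
      _ = _ := by ring

end Uniform

/-- Under the uniform distribution, at least `t r` letters are repeated with probability tending
to one, for `r = n ^ 2 / m` and every `t < 1 / 2`. -/
theorem tendsto_card_compl_repeatWords {m j : ℕ → ℕ} {t : ℝ} (ht : t < 1 / 2)
    (hv : Tendsto (fun n : ℕ => (n : ℝ) / m n) atTop (𝓝 0))
    (hr : Tendsto (fun n : ℕ => (n : ℝ) ^ 2 / m n) atTop atTop)
    (hj : ∀ᶠ n : ℕ in atTop, (j n : ℝ) ≤ t * ((n : ℝ) ^ 2 / m n)) :
    Tendsto (fun n => ((repeatWords (Fin (m n)) n (j n))ᶜ.card : ℝ) / (m n : ℝ) ^ n) atTop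
      (𝓝 0) := by
  obtain ⟨s, hs, hs'⟩ : ∃ s : ℝ, 0 < s ∧ t + 2 * s < 1 / 2 := 
    ⟨(1 / 2 - t) / 4, by linarith, by linarith⟩
  have hlim : Tendsto (fun n : ℕ => 1 / (2 * s ^ 2) / ((n : ℝ) ^ 2 / m n)
      + 1 / (3 * s) * ((n : ℝ) / m n)) atTop (𝓝 0) := by
    have := (hr.const_div_atTop (1 / (2 * s ^ 2))).add (hv.const_mul (1 / (3 * s)))
    rwa [mul_zero, add_zero] at this
  have hn1 : Tendsto (fun n : ℕ => 1 / 2 * (1 - 1 / (n : ℝ))) atTop (𝓝 (1 / 2)) := by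
    have := ((tendsto_one_div_atTop_nhds_zero_nat (𝕜 := ℝ)).const_sub 1).const_mul (1 / 2)
    rwa [sub_zero, mul_one] at this
  refine squeeze_zero' (Eventually.of_forall fun n => by positivity) ?_ hlim
  filter_upwards [hr.eventually_gt_atTop 0, hj, hn1.eventually_const_lt hs',
    eventually_gt_atTop 0] with n hrn hjn hnn hn
  have hn' : (0 : ℝ) < n := by exact_mod_cast hn
  have hm : 0 < m n := by
    by_contra! h
    have : m n = 0 := by omega
    simp [this] at hrn
  have hm' : (0 : ℝ) < m n := by exact_mod_cast hm
  have := card_compl_repeatWords_le (α := Fin (m n)) (n := n) (j := j n)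
    (by simpa using hm) (x := s * ((n : ℝ) ^ 2 / m n)) (by positivity) (by
      rw [Fintype.card_fin]
      have h1 : (n : ℝ) * (n - 1) / 2 / m n
          = 1 / 2 * (1 - 1 / (n : ℝ)) * ((n : ℝ) ^ 2 / m n) := by
        field_simp
      rw [h1]
      have := mul_le_mul_of_nonneg_right hnn.le hrn.le
      linarith)
  rw [Fintype.card_fin] at this
  rw [div_le_iff₀ (by positivity)]
  refine this.trans (le_of_eq ?_)
  congr 1
  field_simp

/-! ### Least favourable alternatives -/

theorem comp_perm_mem_alternatives {m : ℕ} {ε : ℝ} {q : Fin m → ℝ} (hq : q ∈ alternatives m ε)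
    (σ : Equiv.Perm (Fin m)) : q ∘ σ ∈ alternatives m ε := by
  refine ⟨⟨fun c => hq.1.1 _, ?_⟩, hq.2.trans (le_of_eq ?_)⟩
  · rw [← hq.1.2]
    exact Equiv.sum_comp σ q
  · unfold tvDist
    rw [← Equiv.iSup_comp σ.finsetCongr]
    refine iSup_congr fun B => ?_
    simp [Equiv.finsetCongr_apply, Finset.sum_map, unif]

theorem le_tvDist {m : ℕ} (q p : Fin m → ℝ) (B : Finset (Fin m)) :
    |∑ j ∈ B, q j - ∑ j ∈ B, p j| ≤ tvDist q p :=
  le_ciSup (f := fun B : Finset (Fin m) => |∑ j ∈ B, q j - ∑ j ∈ B, p j|)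
    (Set.finite_range _).bddAbove B

/-- The function with value `x` at the first `k` of `m` letters, and `y` at the others. -/
noncomputable def twoLevel (m k : ℕ) (x y : ℝ) : Fin m → ℝ := fun i => if i.val < k then x else y

theorem sum_twoLevel {m k : ℕ} (hk : k ≤ m) (x y : ℝ) :
    ∑ i, twoLevel m k x y i = k * x + (m - k) * y := by
  obtain ⟨l, rfl⟩ := Nat.exists_eq_add_of_le hk
  rw [Fin.sum_univ_add]
  simp [twoLevel]

theorem sum_twoLevel_sq {m k : ℕ} (hk : k ≤ m) (x y : ℝ) :
    ∑ i, twoLevel m k x y i ^ 2 = k * x ^ 2 + (m - k) * y ^ 2 := by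
  rw [← sum_twoLevel hk]
  refine Finset.sum_congr rfl fun i _ => ?_
  unfold twoLevel
  split_ifs <;> rfl

theorem twoLevel_mem_alternatives {m k : ℕ} (hk : k ≤ m) {x y ε : ℝ} (hx : 0 ≤ x) (hy : 0 ≤ y)
    (h1 : k * x + (m - k) * y = 1) (hε : ε ≤ k * x - k / m) :
    twoLevel m k x y ∈ alternatives m ε := by
  refine ⟨⟨fun i => ?_, by rw [sum_twoLevel hk, h1]⟩, ?_⟩
  · unfold twoLevel
    split_ifs <;> assumption
  · refine le_trans ?_ (le_tvDist _ _ (Finset.univ.filter fun i : Fin m => i.val < k))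
    refine le_trans ?_ (le_abs_self _)
    refine hε.trans (le_of_eq ?_)
    obtain ⟨l, rfl⟩ := Nat.exists_eq_add_of_le hk
    rw [Finset.sum_filter, Finset.sum_filter, Fin.sum_univ_add, Fin.sum_univ_add]
    simp [twoLevel, unif, div_eq_mul_inv]

/-- Least favourable alternatives: `q n` is bi-uniform on two halves of the alphabet if `ε < 1 / 2`,
and uniform on the share `1 - ε` of the alphabet if `1 / 2 ≤ ε`, up to rounding. -/
theorem exists_alternatives {ε : ℝ} (hε0 : 0 < ε) (hε1 : ε < 1) {m : ℕ → ℕ}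
    (hm : Tendsto (fun n => (m n : ℝ)) atTop atTop) :
    ∃ (a : ℝ) (q : ∀ n, Fin (m n) → ℝ),
      (∀ᶠ n in atTop, q n ∈ alternatives (m n) ε ∧ ∀ c, q n c ≤ a / m n) ∧
      Tendsto (fun n => m n * ∑ c, q n c ^ 2) atTop (𝓝 (kappa ε)) := by
  have hfloor : ∀ b : ℝ, 0 ≤ b →
      Tendsto (fun n => (⌊b * m n⌋₊ : ℝ) / m n) atTop (𝓝 b) :=
    fun b hb => (tendsto_nat_floor_mul_div_atTop hb).comp hm
  have hle : ∀ b : ℝ, 0 ≤ b → b ≤ 1 → ∀ n, ⌊b * m n⌋₊ ≤ m n := fun b _ hb1 n =>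
    Nat.floor_le_of_le (mul_le_of_le_one_left (Nat.cast_nonneg _) hb1)
  by_cases hε : ε < 1 / 2
  · set k : ℕ → ℕ := fun n => ⌊(1 / 2 : ℝ) * m n⌋₊ with hk
    have hρ : Tendsto (fun n => (k n : ℝ) / m n) atTop (𝓝 (1 / 2)) := hfloor _ (by norm_num)
    have hkm : ∀ n, k n ≤ m n := hle _ (by norm_num) (by norm_num)
    have hkm2 : ∀ n, (k n : ℝ) ≤ 1 / 2 * m n := fun n => Nat.floor_le (by positivity)
    have hev : ∀ᶠ n in atTop, 0 < (m n : ℝ) ∧ 1 / 3 * (m n : ℝ) < k n := by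
      filter_upwards [hm.eventually_gt_atTop 0,
        hρ.eventually_const_lt (by norm_num : (1 / 3 : ℝ) < 1 / 2)] with n hn h
      exact ⟨hn, (lt_div_iff₀ hn).1 h⟩
    refine ⟨4, fun n => twoLevel (m n) (k n) (1 / m n + ε / k n) (1 / m n - ε / (m n - k n)),
      ?_, ?_⟩
    · filter_upwards [hev] with n hn
      obtain ⟨hmn, hkn⟩ := hn
      have hk0 : (0 : ℝ) < k n := by linarith
      have hmk : (0 : ℝ) < m n - k n := by linarith [hkm2 n]
      have h1 : ε / (m n - k n) ≤ 1 / m n := by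
        rw [div_le_div_iff₀ hmk hmn]
        nlinarith [hkm2 n]
      have h2 : ε / k n ≤ 3 / m n := by
        rw [div_le_div_iff₀ hk0 hmn]
        nlinarith
      have h3 : 0 ≤ ε / (m n - k n) := by positivity
      have h4 : 0 ≤ 3 / (m n : ℝ) := by positivity
      have h5 : (4 : ℝ) / m n = 1 / m n + 3 / m n := by ring
      refine ⟨twoLevel_mem_alternatives (hkm n) (by positivity) (by linarith) ?_ (le_of_eq ?_), ?_⟩
      · field_simp
        ring
      · field_simp
        ring
      · intro c
        rw [h5]
        unfold twoLevel
        split_ifs <;> linarith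
    · have hlim : Tendsto (fun n => 1 + ε ^ 2 * (1 / ((k n : ℝ) / m n) + 1 / (1 - (k n : ℝ) / m n)))
          atTop (𝓝 (kappa ε)) := by
        have h0 : kappa ε = 1 + ε ^ 2 * (1 / (1 / 2) + 1 / (1 - 1 / 2)) := by
          rw [kappa, if_pos hε]
          ring
        rw [h0]
        exact (((tendsto_const_nhds.div hρ (by norm_num)).add
          (tendsto_const_nhds.div (hρ.const_sub 1) (by norm_num))).const_mul _).const_add _
      refine hlim.congr' ?_
      filter_upwards [hev] with n hn
      obtain ⟨hmn, hkn⟩ := hn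
      have hk0 : (0 : ℝ) < k n := by linarith
      have hmk : (0 : ℝ) < m n - k n := by linarith [hkm2 n]
      rw [sum_twoLevel_sq (hkm n)]
      have h6 : 1 - (k n : ℝ) / m n = (m n - k n) / m n := by field_simp
      rw [h6]
      obtain ⟨l, hl⟩ : ∃ l : ℝ, l = m n - k n := ⟨_, rfl⟩
      rw [← hl] at hmk ⊢
      have hml : (m n : ℝ) = k n + l := by linarith
      rw [hml] at hmn ⊢
      field_simp
      ring
  · have hb0 : 0 < 1 - ε := by linarith
    set k : ℕ → ℕ := fun n => ⌊(1 - ε) * m n⌋₊ with hk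
    have hρ : Tendsto (fun n => (k n : ℝ) / m n) atTop (𝓝 (1 - ε)) := hfloor _ hb0.le
    have hkm : ∀ n, k n ≤ m n := hle _ hb0.le (by linarith)
    have hkm2 : ∀ n, (k n : ℝ) ≤ (1 - ε) * m n := fun n => Nat.floor_le (by positivity)
    have hev : ∀ᶠ n in atTop, 0 < (m n : ℝ) ∧ (1 - ε) / 2 * (m n : ℝ) < k n := by
      filter_upwards [hm.eventually_gt_atTop 0,
        hρ.eventually_const_lt (by linarith : (1 - ε) / 2 < 1 - ε)] with n hn h
      exact ⟨hn, (lt_div_iff₀ hn).1 h⟩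
    refine ⟨2 / (1 - ε), fun n => twoLevel (m n) (k n) (1 / k n) 0, ?_, ?_⟩
    · filter_upwards [hev] with n hn
      obtain ⟨hmn, hkn⟩ := hn
      have hk0 : (0 : ℝ) < k n := lt_of_le_of_lt (by positivity) hkn
      refine ⟨twoLevel_mem_alternatives (hkm n) (by positivity) le_rfl ?_ ?_, ?_⟩
      · field_simp
        ring
      · rw [mul_one_div_cancel hk0.ne', le_sub_comm, div_le_iff₀ hmn]
        exact hkm2 n
      · intro c
        have h1 : 1 / (k n : ℝ) ≤ 2 / (1 - ε) / m n := by
          rw [div_div, div_le_div_iff₀ hk0 (by positivity)]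
          linarith
        have h2 : 0 ≤ 2 / (1 - ε) / (m n : ℝ) := by positivity
        unfold twoLevel
        split_ifs <;> assumption
    · have hlim : Tendsto (fun n => 1 / ((k n : ℝ) / m n)) atTop (𝓝 (kappa ε)) := by
        have h0 : kappa ε = 1 / (1 - ε) := by
          rw [kappa, if_neg hε]
          field_simp
          ring
        rw [h0]
        exact tendsto_const_nhds.div hρ hb0.ne'
      refine hlim.congr' ?_
      filter_upwards [hev] with n hn
      obtain ⟨hmn, hkn⟩ := hn
      have hk0 : (0 : ℝ) < k n := lt_of_le_of_lt (by positivity) hkn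
      rw [sum_twoLevel_sq (hkm n)]
      field_simp
      ring

/-! ### Exponents of sequences of probabilities -/

theorem neg_le_exponent_term {r R : ℝ} {P : ℝ≥0∞} (hr : 0 < r) {c δ : ℝ} (hc : 0 < c)
    (hδ : -Real.log c ≤ r * δ) (h : ENNReal.ofReal (c * Real.exp (-(r * R))) ≤ P) :
    -((R + δ : ℝ) : EReal) ≤ ((1 / r : ℝ) : EReal) * ENNReal.log P := by
  have hlog := ENNReal.log_le_log h
  rw [ENNReal.log_ofReal_of_pos (by positivity), Real.log_mul hc.ne' (Real.exp_ne_zero _),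
    Real.log_exp] at hlog
  have hr0 : (0 : EReal) ≤ ((1 / r : ℝ) : EReal) := by
    exact_mod_cast (by positivity : (0 : ℝ) ≤ 1 / r)
  refine le_trans ?_ (mul_le_mul_of_nonneg_left hlog hr0)
  rw [← EReal.coe_neg, ← EReal.coe_mul, EReal.coe_le_coe_iff, one_div, inv_mul_eq_div,
    le_div_iff₀ hr]
  linarith

theorem genExponent_le {m : ℕ → ℕ} {P : ℕ → ℝ≥0∞} {c R δ : ℝ} (hc : 0 < c) (hδ : 0 < δ)
    (hr : Tendsto (fun n : ℕ => (n : ℝ) ^ 2 / m n) atTop atTop)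
    (h : ∃ᶠ n : ℕ in atTop, ENNReal.ofReal (c * Real.exp (-((n : ℝ) ^ 2 / m n * R))) ≤ P n) :
    genExponent m P ≤ ((R + δ : ℝ) : EReal) := by
  rw [genExponent, EReal.neg_le]
  refine le_limsup_of_frequently_le ?_
  refine (h.and_eventually ((hr.eventually_gt_atTop 0).and
    ((hr.atTop_mul_const hδ).eventually_ge_atTop (-Real.log c)))).mono fun n hn => ?_
  exact neg_le_exponent_term hn.2.1 hc hn.2.2 hn.1

theorem eventually_le_of_lt_genExponent {m : ℕ → ℕ} {P : ℕ → ℝ≥0∞} {R : ℝ}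
    (hr : Tendsto (fun n : ℕ => (n : ℝ) ^ 2 / m n) atTop atTop)
    (h : (R : EReal) < genExponent m P) :
    ∀ᶠ n : ℕ in atTop, P n ≤ ENNReal.ofReal (Real.exp (-((n : ℝ) ^ 2 / m n * R))) := by
  rw [genExponent, EReal.lt_neg_comm] at h
  filter_upwards [eventually_lt_of_limsup_lt h, hr.eventually_gt_atTop 0] with n hn hrn
  by_contra! hP
  have := neg_le_exponent_term (P := P n) (R := R) (c := 1) (δ := 0) hrn one_pos (by simp)
    (by rw [one_mul]; exact hP.le)
  rw [add_zero] at this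
  exact absurd hn (not_lt.2 this)

/-! ### The converse bound -/

theorem sum_prod_unif {m n : ℕ} (A : Finset (Fin n → Fin m)) :
    ∑ z ∈ A, ∏ i, unif m (z i) = A.card / (m : ℝ) ^ n := by
  simp [unif, div_eq_mul_inv]

/-- A set `B` of accepted words with at least `j` repeated letters forces a missed detection
probability comparable to the probability of `pairWords` under any alternative. -/
theorem ofReal_le_probMissed {m n j : ℕ} {ε c : ℝ} {φ : (Fin n → Fin m) → Bool} (hn : n ≤ m)
    {q : Fin m → ℝ} (hq : q ∈ alternatives m ε) {B : Finset (Fin n → Fin m)}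
    (hB : B ⊆ repeatWords (Fin m) n j) (hφ : ∀ z ∈ B, φ z = false)
    (hc : c * (pairWords (Fin m) n j).card ≤ B.card) :
    ENNReal.ofReal (c * ∑ z ∈ pairWords (Fin m) n j, ∏ i, q (z i)) ≤ probMissed ε φ := by
  obtain ⟨σ, hσ⟩ := exists_perm_prob_ge hq.1.1 (by simpa using hn) hB
  refine le_trans ?_ (le_iSup₂ (f := fun q _ => iidProb q {z | φ z = false}) (q ∘ σ)
    (comp_perm_mem_alternatives hq σ))
  refine ENNReal.ofReal_le_ofReal ?_
  have hpos : ∀ z : Fin n → Fin m, 0 ≤ ∏ i, q (σ (z i)) := fun z =>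
    Finset.prod_nonneg fun i _ => hq.1.1 _
  have hsub : ∑ z ∈ B, ∏ i, q (σ (z i)) ≤ ∑ z with φ z = false, ∏ i, (q ∘ σ) (z i) :=
    Finset.sum_le_sum_of_subset_of_nonneg (fun z hz => by simpa using hφ z hz)
      fun z _ _ => hpos z
  refine le_trans ?_ hsub
  rcases (pairWords (Fin m) n j).eq_empty_or_nonempty with h | h
  · rw [h, Finset.sum_empty, mul_zero]
    exact Finset.sum_nonneg fun z _ => hpos z
  · have hA : (0 : ℝ) < (pairWords (Fin m) n j).card := by exact_mod_cast h.card_pos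
    have hQ : 0 ≤ ∑ z ∈ pairWords (Fin m) n j, ∏ i, q (z i) :=
      Finset.sum_nonneg fun z _ => Finset.prod_nonneg fun i _ => hq.1.1 _
    refine le_of_mul_le_mul_left (le_trans ?_ hσ) hA
    have := mul_le_mul_of_nonneg_left hc hQ
    linarith

theorem tendsto_floor_mul_div {r : ℕ → ℝ} (hr : Tendsto r atTop atTop) {t : ℝ} (ht : 0 ≤ t) :
    Tendsto (fun n => (⌊t * r n⌋₊ : ℝ) / r n) atTop (𝓝 t) :=
  (tendsto_nat_floor_mul_div_atTop ht).comp hr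

theorem expMissed_le_poissonRate {ε : ℝ} (hε0 : 0 < ε) (hε1 : ε < 1) {m : ℕ → ℕ}
    (hm : ∀ᶠ n in atTop, n ≤ m n)
    (hv : Tendsto (fun n : ℕ => (n : ℝ) / m n) atTop (𝓝 0))
    (hr : Tendsto (fun n : ℕ => (n : ℝ) ^ 2 / m n) atTop atTop)
    {φ : ∀ n : ℕ, (Fin n → Fin (m n)) → Bool} {t c : ℝ} (ht : 0 < t) (hc : 0 < c)
    (hB : ∃ᶠ n : ℕ in atTop, ∃ B ⊆ repeatWords (Fin (m n)) n ⌊t * ((n : ℝ) ^ 2 / m n)⌋₊,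
      (∀ z ∈ B, φ n z = false) ∧
      c * (pairWords (Fin (m n)) n ⌊t * ((n : ℝ) ^ 2 / m n)⌋₊).card ≤ B.card) :
    expMissed m ε φ ≤ (poissonRate (kappa ε) t : EReal) := by
  have hmr : Tendsto (fun n => (m n : ℝ)) atTop atTop :=
    tendsto_atTop_mono' _ (hm.mono fun n hn => Nat.cast_le.2 hn) tendsto_natCast_atTop_atTop
  have hκ : 0 < kappa ε := by
    unfold kappa
    have : 0 < 1 - ε := by linarith
    split_ifs <;> positivity
  obtain ⟨a, q, hq, hk⟩ := exists_alternatives hε0 hε1 hmr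
  have key : ∀ δ : ℝ, 0 < δ →
      expMissed m ε φ ≤ ((poissonRate (kappa ε) t + δ + δ : ℝ) : EReal) := by
    intro δ hδ
    have hprob := eventually_exp_le_sum_pairWords hκ ht hδ hv hr
      (hq.mono fun n hn => ⟨hn.1.1.1, hn.1.1.2, hn.2⟩) hk (tendsto_floor_mul_div hr ht.le)
    refine genExponent_le hc hδ hr ((hB.and_eventually (hprob.and (hq.and hm))).mono ?_)
    rintro n ⟨⟨B, hBr, hBφ, hBc⟩, hp, hqn, hmn⟩
    refine le_trans (ENNReal.ofReal_le_ofReal ?_) (ofReal_le_probMissed hmn hqn.1 hBr hBφ hBc)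
    exact mul_le_mul_of_nonneg_left hp hc.le
  have hlim : Tendsto (fun δ : ℝ => ((poissonRate (kappa ε) t + δ + δ : ℝ) : EReal)) (𝓝[>] 0)
      (𝓝 (poissonRate (kappa ε) t : EReal)) := by
    refine (continuous_coe_real_ereal.tendsto _).comp (tendsto_nhdsWithin_of_tendsto_nhds ?_)
    have : Continuous fun δ : ℝ => poissonRate (kappa ε) t + δ + δ := by fun_prop
    simpa using this.tendsto 0
  exact ge_of_tendsto hlim (eventually_mem_nhdsWithin.mono fun δ hδ => key δ hδ)

/-- The supremum defining `J_M^*` is at least its value at the tilting parameter that moves the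
Poisson mean from `κ r / 2` to `(1 + τ) r / 2`. -/
theorem poissonRate_le_optMissed {ε τ : ℝ} (hτ : τ ∈ Set.Icc 0 (kappa ε - 1)) :
    (poissonRate (kappa ε) ((1 + τ) / 2) : EReal) ≤ optMissed ε τ := by
  have h1 : 0 < 1 + τ := by linarith [hτ.1]
  have h2 : 1 + τ ≤ kappa ε := by linarith [hτ.2]
  have hκ : 0 < kappa ε := h1.trans_le h2
  have hθ : 0 ≤ 1 / 2 * Real.log (kappa ε / (1 + τ)) :=
    mul_nonneg (by norm_num) (Real.log_nonneg ((one_le_div h1).2 h2))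
  refine le_trans (le_of_eq ?_) (le_iSup₂ (f := fun (θ : ℝ) (_ : 0 ≤ θ) =>
    ((θ * (kappa ε - 1 - τ)
      - 1 / 2 * (Real.exp (-2 * θ) - (1 - 2 * θ)) * kappa ε : ℝ) : EReal)) _ hθ)
  have hexp : Real.exp (-2 * (1 / 2 * Real.log (kappa ε / (1 + τ)))) = (1 + τ) / kappa ε := by
    have : -2 * (1 / 2 * Real.log (kappa ε / (1 + τ))) = Real.log ((1 + τ) / kappa ε) := by
      rw [← inv_div (kappa ε) (1 + τ), Real.log_inv]
      ring
    rw [this, Real.exp_log (by positivity)]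
  rw [hexp, poissonRate, mul_div_cancel₀ (1 + τ) two_ne_zero]
  congr 1
  field_simp
  ring

/-- Below the threshold `(1 + τ) / 2`, the Poisson rate under the null hypothesis is smaller than
`J_F^*(τ)`. -/
theorem exists_poissonRate_lt_optFalseAlarm {τ t : ℝ} (ht : 1 / 2 < t) (htτ : t < (1 + τ) / 2) :
    ∃ R : ℝ, poissonRate 1 t < R ∧ (R : EReal) ≤ optFalseAlarm τ := by
  have h1 : 0 < Real.log (2 * t) := Real.log_pos (by linarith)
  refine ⟨_, ?_, le_iSup₂ (f := fun (θ : ℝ) (_ : 0 ≤ θ) =>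
    ((θ * τ - 1 / 2 * (Real.exp (2 * θ) - (1 + 2 * θ)) : ℝ) : EReal))
    (1 / 2 * Real.log (2 * t)) (by positivity)⟩
  have hexp : Real.exp (2 * (1 / 2 * Real.log (2 * t))) = 2 * t := by
    rw [← mul_assoc, mul_one_div_cancel two_ne_zero, one_mul, Real.exp_log (by linarith)]
  rw [hexp, poissonRate, one_div (2 * t), Real.log_inv]
  nlinarith

theorem card_filter_true_add_card_filter_false {m n : ℕ} (φ : (Fin n → Fin m) → Bool) :
    (Finset.univ.filter fun z => φ z = true).card + (Finset.univ.filter fun z => φ z = false).card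
      = m ^ n := by
  have := Finset.card_filter_add_card_filter_not (s := Finset.univ) fun z => φ z = true
  simpa using this

/-- For `t` above `1 / 2`, a test whose false alarm probability is much smaller than the probability
of `⌊t r⌋` repeated letters under the null hypothesis accepts at least half of the words in
`pairWords`. -/
theorem eventually_card_accepted_pairWords {m : ℕ → ℕ}
    (hv : Tendsto (fun n : ℕ => (n : ℝ) / m n) atTop (𝓝 0))
    (hr : Tendsto (fun n : ℕ => (n : ℝ) ^ 2 / m n) atTop atTop)
    {φ : ∀ n : ℕ, (Fin n → Fin (m n)) → Bool} {t R : ℝ} (ht : 0 < t) (hR : poissonRate 1 t < R)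
    (hF : (R : EReal) ≤ expFalseAlarm m φ) :
    ∀ᶠ n : ℕ in atTop, 1 / 2 * ((pairWords (Fin (m n)) n ⌊t * ((n : ℝ) ^ 2 / m n)⌋₊).card : ℝ) ≤
      ((pairWords (Fin (m n)) n ⌊t * ((n : ℝ) ^ 2 / m n)⌋₊).filter fun z => φ n z = false).card := by
  obtain ⟨δ, hδ, hδR⟩ : ∃ δ : ℝ, 0 < δ ∧ poissonRate 1 t + δ + δ < R :=
    ⟨(R - poissonRate 1 t) / 3, by linarith, by linarith⟩
  have hm0 : ∀ᶠ n in atTop, (0 : ℝ) < m n := by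
    filter_upwards [hr.eventually_gt_atTop 0] with n hn
    by_contra! h
    have : (m n : ℝ) = 0 := le_antisymm h (Nat.cast_nonneg _)
    simp [this] at hn
  have hPF := eventually_le_of_lt_genExponent (P := fun n => probFalseAlarm (φ n)) hr
    ((EReal.coe_lt_coe_iff.2 hδR).trans_le hF)
  have hprob := eventually_exp_le_sum_pairWords (q := fun n => unif (m n)) (a := 1) one_pos ht hδ
    hv hr (by
      filter_upwards [hm0] with n hn
      refine ⟨fun c => by unfold unif; positivity, ?_, fun c => le_rfl⟩
      simp [unif, hn.ne']) (by
      refine tendsto_const_nhds.congr' ?_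
      filter_upwards [hm0] with n hn
      simp only [unif, Finset.sum_const, Finset.card_univ, Fintype.card_fin, nsmul_eq_mul]
      field_simp) (tendsto_floor_mul_div hr ht.le)
  filter_upwards [hPF, hprob, hm0, hr.eventually_gt_atTop 0,
    (hr.atTop_mul_const hδ).eventually_ge_atTop (Real.log 2)] with n h1 h2 hmn hrn h3
  set r : ℝ := (n : ℝ) ^ 2 / m n
  set A := pairWords (Fin (m n)) n ⌊t * r⌋₊
  rw [sum_prod_unif] at h2
  have hmp : (0 : ℝ) < (m n : ℝ) ^ n := by positivity
  have h4 : ((Finset.univ.filter fun z => φ n z = true).card : ℝ) / (m n : ℝ) ^ n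
      ≤ Real.exp (-(r * (poissonRate 1 t + δ + δ))) := by
    rw [probFalseAlarm, iidProb, sum_prod_unif] at h1
    exact (ENNReal.ofReal_le_ofReal_iff (Real.exp_pos _).le).1 h1
  have h5 : Real.exp (-(r * (poissonRate 1 t + δ + δ)))
      ≤ 1 / 2 * Real.exp (-(r * (poissonRate 1 t + δ))) := by
    have : (1 / 2 : ℝ) = Real.exp (-Real.log 2) := by
      rw [Real.exp_neg, Real.exp_log two_pos, one_div]
    rw [this, ← Real.exp_add]
    refine Real.exp_le_exp.2 ?_
    linarith
  have h6 : ((Finset.univ.filter fun z => φ n z = true).card : ℝ) ≤ 1 / 2 * A.card := by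
    have h7 := h4.trans (h5.trans (mul_le_mul_of_nonneg_left h2 (by norm_num)))
    rw [← mul_div_assoc] at h7
    exact (div_le_div_iff_of_pos_right hmp).1 h7
  have h8 : A.card ≤ (A.filter fun z => φ n z = false).card
      + (Finset.univ.filter fun z => φ n z = true).card := by
    rw [← Finset.card_filter_add_card_filter_not (s := A) fun z => φ n z = false]
    refine Nat.add_le_add_left (Finset.card_le_card fun z => ?_) _
    simp
  have h9 : (A.card : ℝ) ≤ (A.filter fun z => φ n z = false).card
      + (Finset.univ.filter fun z => φ n z = true).card := by exact_mod_cast h8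
  linarith

/-- For `t` below `1 / 2`, almost all words have `⌊t r⌋` repeated letters under the null hypothesis,
so that a test whose false alarm probability does not tend to one accepts a positive share of
them, infinitely often. -/
theorem frequently_card_accepted_repeatWords {m : ℕ → ℕ} (hm : ∀ᶠ n in atTop, 0 < m n)
    (hv : Tendsto (fun n : ℕ => (n : ℝ) / m n) atTop (𝓝 0))
    (hr : Tendsto (fun n : ℕ => (n : ℝ) ^ 2 / m n) atTop atTop)
    {φ : ∀ n : ℕ, (Fin n → Fin (m n)) → Bool} {t : ℝ} (ht0 : 0 < t) (ht : t < 1 / 2)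
    (hφ : ¬ Tendsto (fun n => probFalseAlarm (φ n)) atTop (𝓝 1)) :
    ∃ c : ℝ, 0 < c ∧ ∃ᶠ n : ℕ in atTop, c * (m n : ℝ) ^ n ≤
      ((repeatWords (Fin (m n)) n ⌊t * ((n : ℝ) ^ 2 / m n)⌋₊).filter
        fun z => φ n z = false).card := by
  set a : ℕ → ℝ := fun n => (Finset.univ.filter fun z => φ n z = false).card / (m n : ℝ) ^ n with ha
  have ha0 : ∀ n, 0 ≤ a n := fun n => by positivity
  have hPa : ∀ᶠ n in atTop, probFalseAlarm (φ n) = ENNReal.ofReal (1 - a n) := by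
    filter_upwards [hm] with n hn
    have hmp : (0 : ℝ) < (m n : ℝ) ^ n := by
      have : (0 : ℝ) < m n := by exact_mod_cast hn
      positivity
    have h1 : ((Finset.univ.filter fun z => φ n z = true).card : ℝ)
        + (Finset.univ.filter fun z => φ n z = false).card = (m n : ℝ) ^ n := by
      exact_mod_cast card_filter_true_add_card_filter_false (φ n)
    rw [probFalseAlarm, iidProb, sum_prod_unif]
    congr 1
    simp only [ha]
    rw [eq_sub_iff_add_eq, ← add_div, h1, div_self hmp.ne']
  have hna : ¬ Tendsto a atTop (𝓝 0) := by
    intro h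
    refine hφ ?_
    have h1 : Tendsto (fun n => ENNReal.ofReal (1 - a n)) atTop (𝓝 1) := by
      have := ENNReal.tendsto_ofReal (h.const_sub 1)
      simpa using this
    exact h1.congr' (hPa.mono fun n hn => hn.symm)
  obtain ⟨c, hc, hfr⟩ : ∃ c : ℝ, 0 < c ∧ ∃ᶠ n in atTop, c ≤ a n := by
    by_contra! hcon
    refine hna (Metric.tendsto_nhds.2 fun e he => ?_)
    have := hcon e he
    refine this.mono fun n hn => ?_
    rw [Real.dist_eq, sub_zero, abs_of_nonneg (ha0 n)]
    exact hn
  refine ⟨c / 2, by positivity, ?_⟩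
  have hlln := tendsto_card_compl_repeatWords ht hv hr
    ((hr.eventually_gt_atTop 0).mono fun n hn => Nat.floor_le (by positivity))
  refine (hfr.and_eventually (hm.and (hlln.eventually_lt_const (half_pos hc)))).mono ?_
  rintro n ⟨h1, hmn, h2⟩
  have hmp : (0 : ℝ) < (m n : ℝ) ^ n := by
    have : (0 : ℝ) < m n := by exact_mod_cast hmn
    positivity
  rw [div_lt_iff₀ hmp] at h2
  simp only [ha] at h1
  rw [le_div_iff₀ hmp] at h1
  set W := repeatWords (Fin (m n)) n ⌊t * ((n : ℝ) ^ 2 / m n)⌋₊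
  have h3 : (Finset.univ.filter fun z => φ n z = false).card
      ≤ (W.filter fun z => φ n z = false).card + Wᶜ.card := by
    refine (Finset.card_le_card fun z hz => ?_).trans (Finset.card_union_le _ _)
    have hz' := (Finset.mem_filter.1 hz).2
    by_cases hzW : z ∈ W
    · exact Finset.mem_union_left _ (Finset.mem_filter.2 ⟨hzW, hz'⟩)
    · exact Finset.mem_union_right _ (Finset.mem_compl.2 hzW)
  have h4 : ((Finset.univ.filter fun z => φ n z = false).card : ℝ)
      ≤ (W.filter fun z => φ n z = false).card + Wᶜ.card := by exact_mod_cast h3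
  linarith

end SmallSampleTesting

theorem theorem2
    (ε : ℝ) (hε0 : 0 < ε) (hε1 : ε < 1)
    (m : ℕ → ℕ)
    (hnm : (fun n : ℕ => (n : ℝ)) =o[atTop] fun n : ℕ => (m n : ℝ))
    (hmn : (fun n : ℕ => (m n : ℝ)) =o[atTop] fun n : ℕ => (n : ℝ) ^ 2)
    (τ : ℝ) (hτ : τ ∈ Set.Icc 0 (SmallSampleTesting.kappa ε - 1))
    (φ : ∀ n : ℕ, (Fin n → Fin (m n)) → Bool)
    (hφ0 : τ = 0 →
      ¬ Tendsto (fun n => SmallSampleTesting.probFalseAlarm (φ n)) atTop (𝓝 1))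
    (hF : SmallSampleTesting.optFalseAlarm τ ≤ SmallSampleTesting.expFalseAlarm m φ) :
    SmallSampleTesting.expMissed m ε φ ≤ SmallSampleTesting.optMissed ε τ := by
  open SmallSampleTesting in
  have hm : ∀ᶠ n in atTop, n ≤ m n := by
    filter_upwards [hnm.bound one_pos] with n hn
    simp only [Real.norm_natCast, one_mul] at hn
    exact_mod_cast hn
  have hm0 : ∀ᶠ n in atTop, 0 < m n := by
    filter_upwards [hm, eventually_gt_atTop 0] with n h1 h2
    omega
  have hv : Tendsto (fun n : ℕ => (n : ℝ) / m n) atTop (𝓝 0) := hnm.tendsto_div_nhds_zero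
  have hr : Tendsto (fun n : ℕ => (n : ℝ) ^ 2 / m n) atTop atTop := by
    have h1 : Tendsto (fun n : ℕ => (m n : ℝ) / (n : ℝ) ^ 2) atTop (𝓝[>] 0) := by
      refine tendsto_nhdsWithin_iff.2 ⟨hmn.tendsto_div_nhds_zero, ?_⟩
      filter_upwards [hm0, eventually_gt_atTop 0] with n h1 h2
      have h1' : (0 : ℝ) < m n := by exact_mod_cast h1
      have h2' : (0 : ℝ) < n := by exact_mod_cast h2
      exact div_pos h1' (by positivity)
    refine (tendsto_inv_nhdsGT_zero.comp h1).congr fun n => ?_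
    simp
  -- It suffices to bound the exponent by the Poisson rate at thresholds `t` just below
  -- `(1 + τ) / 2`; the rate is continuous in `t`.
  suffices h : ∀ᶠ t in 𝓝[<] ((1 + τ) / 2), expMissed m ε φ ≤ (poissonRate (kappa ε) t : EReal) by
    refine le_trans (ge_of_tendsto ?_ h) (poissonRate_le_optMissed hτ)
    have hpos : 0 < (1 + τ) / 2 := by linarith [hτ.1]
    have hκ : 0 < kappa ε := by linarith [hτ.1, hτ.2]
    refine (continuous_coe_real_ereal.tendsto _).comp (tendsto_nhdsWithin_of_tendsto_nhds ?_)
    have hlog : Tendsto (fun t => Real.log (kappa ε / (2 * t))) (𝓝 ((1 + τ) / 2))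
        (𝓝 (Real.log (kappa ε / (2 * ((1 + τ) / 2))))) :=
      (tendsto_const_nhds.div (tendsto_id.const_mul 2) (by positivity)).log (by positivity)
    exact (tendsto_id.mul (hlog.add_const 1)).const_sub _
  rcases hτ.1.eq_or_lt with h0 | h0
  · subst h0
    have hI : Set.Ioo (0 : ℝ) ((1 + 0) / 2) ∈ 𝓝[<] (((1 : ℝ) + 0) / 2) :=
      Ioo_mem_nhdsLT (by norm_num)
    filter_upwards [hI] with t ht
    obtain ⟨c, hc, hfr⟩ := frequently_card_accepted_repeatWords hm0 hv hr ht.1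
      (by simpa using ht.2) (hφ0 rfl)
    refine expMissed_le_poissonRate hε0 hε1 hm hv hr ht.1 hc (hfr.mono fun n hn => ?_)
    refine ⟨_, Finset.filter_subset _ _, fun z hz => (Finset.mem_filter.1 hz).2, le_trans ?_ hn⟩
    refine mul_le_mul_of_nonneg_left ?_ hc.le
    have := Finset.card_le_univ (pairWords (Fin (m n)) n ⌊t * ((n : ℝ) ^ 2 / m n)⌋₊)
    rw [Fintype.card_fun, Fintype.card_fin, Fintype.card_fin] at this
    exact_mod_cast this
  · have hI : Set.Ioo (1 / 2 : ℝ) ((1 + τ) / 2) ∈ 𝓝[<] ((1 + τ) / 2) :=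
      Ioo_mem_nhdsLT (by linarith)
    filter_upwards [hI] with t ht
    have ht0 : 0 < t := by linarith [ht.1]
    obtain ⟨R, hR, hRF⟩ := exists_poissonRate_lt_optFalseAlarm ht.1 ht.2
    have hev := eventually_card_accepted_pairWords hv hr ht0 hR (hRF.trans hF)
    refine expMissed_le_poissonRate hε0 hε1 hm hv hr ht0 one_half_pos
      (hev.frequently.mono fun n hn => ?_)
    exact ⟨_, (Finset.filter_subset _ _).trans (pairWords_subset_repeatWords _ _),
      fun z hz => (Finset.mem_filter.1 hz).2, hn⟩
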